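/- Let $(M,g)$ be a connected, oriented, smooth Riemannian surface (without boundary), and let $F_1,F_2:M\to\mathbb{R}^3$ be smooth isometric embeddings, i.e. smooth maps which are homeomorphisms onto their images and satisfy $\langle dF_i(v),dF_i(w)\rangle=g(v,w)$ for all tangent vectors $v,w$ at the same point. Let $N_i$ be the unit normal field of $F_i$ determined by the orientations of $M$ and $\mathbb{R}^3$, that is, $N_i=\frac{dF_i(e_1)\times dF_i(e_2)}{|dF_i(e_1)\times dF_i(e_2)|}$ for every positively oriented basis $(e_1,e_2)$ of a tangent plane of $M$. The principal curvatures of $F_i$ at $p\in M$ are the eigenvalues, with respect to $g$, of the second fundamental form $\mathrm{II}_i(v,w)=-\langle dN_i(v),dF_i(w)\rangle$ on $T_pM$. For a subset $U\subseteq M$, say that $F_1$ and $F_2$ are congruent on $U$ (written $F_1\sim F_2$ on $U$) if there is an orientation-preserving rigid motion $A$ of $\mathbb{R}^3$ with $F_2(p)=A(F_1(p))$ for all $p\in U$. Suppose that $F_1$ and $F_2$ have the same principal curvatures at every point of $M$. If $F_1\sim F_2$ on some nonempty open subset of $M$, then $F_1\sim F_2$ on $M$. -/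

import Mathlib

open scoped Manifold ContDiff RealInnerProductSpace

noncomputable section

namespace SurfaceCongruence

/-- The plane `ℝ²`, on which surfaces are modelled. -/
abbrev Plane : Type := EuclideanSpace ℝ (Fin 2)

/-- Euclidean space `ℝ³`. -/
abbrev Space : Type := EuclideanSpace ℝ (Fin 3)

/-- The atlas of the surface `M` is oriented: every change of charts has positive Jacobian
determinant. A smooth surface with such an atlas is an oriented surface, its positive bases of
tangent vectors being those with the orientation of the coordinate basis of any chart. -/
class OrientedAtlas (M : Type*) [TopologicalSpace M] [ChartedSpace Plane M] : Prop where
  det_pos : ∀ e ∈ atlas Plane M, ∀ e' ∈ atlas Plane M, ∀ u ∈ (e.symm ≫ₕ e').source,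
    0 < (fderiv ℝ (e.symm ≫ₕ e') u).det

/-- A smooth Riemannian metric on the surface `M`. -/
abbrev SurfaceMetric (M : Type*) [TopologicalSpace M] [ChartedSpace Plane M] [IsManifold (𝓡 2) ∞ M] :
    Type _ :=
  Bundle.ContMDiffRiemannianMetric (𝓡 2) ∞ Plane (fun x : M ↦ TangentSpace (𝓡 2) x)

section

variable {M : Type*} [TopologicalSpace M] [ChartedSpace Plane M]

/-- The differential `dF : T_x M → ℝ³` of a map `F : M → ℝ³`. -/
def differential (F : M → Space) (x : M) : TangentSpace (𝓡 2) x →L[ℝ] Space :=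
  mfderiv (𝓡 2) 𝓘(ℝ, Space) F x

/-- The coordinate basis of `T_x M` given by the chart `chartAt Plane x`, which is the chart through
which `TangentSpace (𝓡 2) x` is identified with `ℝ²`. If the atlas of `M` is oriented, this basis is
positive. -/
def coordVector (x : M) (i : Fin 2) : TangentSpace (𝓡 2) x :=
  (EuclideanSpace.single i (1 : ℝ) : Plane)

/-- The cross product of two vectors of Euclidean space `ℝ³`. -/
def cross (a b : Space) : Space :=
  WithLp.toLp 2 (crossProduct (WithLp.ofLp a) (WithLp.ofLp b))

/-- The unit normal field `N` of an immersion `F` of an oriented surface, determined by the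
orientations of `M` and of `ℝ³`: `N = dF(e₀) × dF(e₁) / |dF(e₀) × dF(e₁)|` for a positive basis
`(e₀, e₁)` of the tangent plane. (It is the same for all positive bases.) -/
def unitNormal (F : M → Space) (x : M) : Space :=
  let n := cross (differential F x (coordVector x 0)) (differential F x (coordVector x 1))
  ‖n‖⁻¹ • n

/-- The second fundamental form `II(v, w) = -⟨dN(v), dF(w)⟩` of an immersion of an oriented surface,
with respect to its unit normal field `N`. -/
def secondFundamentalForm (F : M → Space) (x : M) (v w : TangentSpace (𝓡 2) x) : ℝ :=
  -⟪differential (unitNormal F) x v, differential F x w⟫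

variable [IsManifold (𝓡 2) ∞ M]

/-- `F : (M, g) → ℝ³` is a smooth isometric embedding: a smooth topological embedding with
`⟨dF(v), dF(w)⟩ = g(v, w)`. (The last property makes it an immersion.) -/
structure IsIsometricEmbedding (g : SurfaceMetric M) (F : M → Space) : Prop where
  contMDiff : ContMDiff (𝓡 2) 𝓘(ℝ, Space) ∞ F
  isEmbedding : Topology.IsEmbedding F
  isometric : ∀ (x : M) (v w : TangentSpace (𝓡 2) x),
    ⟪differential F x v, differential F x w⟫ = g.inner x v w

/-- The principal curvatures at `x` of an isometric immersion `F` of `(M, g)`: the eigenvalues of the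
second fundamental form with respect to `g`. The tangent plane is two-dimensional, so the set of
the eigenvalues (one or two numbers) determines their multiplicities. -/
def principalCurvatures (g : SurfaceMetric M) (F : M → Space) (x : M) : Set ℝ :=
  {k | ∃ v : TangentSpace (𝓡 2) x, v ≠ 0 ∧
    ∀ w : TangentSpace (𝓡 2) x, secondFundamentalForm F x v w = k * g.inner x v w}

end

/-- `F₁` and `F₂` are congruent on the set `U`: a (proper, i.e. orientation preserving) rigid motion
of `ℝ³` takes `F₁` to `F₂` on `U`. -/
def CongruentOn {M : Type*} (F₁ F₂ : M → Space) (U : Set M) : Prop :=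
  ∃ A : Space ≃ᵃⁱ[ℝ] Space,
    LinearMap.det (A.linearIsometryEquiv.toLinearEquiv : Space →ₗ[ℝ] Space) = 1 ∧
      ∀ x ∈ U, F₂ x = A (F₁ x)

/-- `F₁` and `F₂` are congruent (on the whole surface). -/
def AreCongruent {M : Type*} (F₁ F₂ : M → Space) : Prop :=
  CongruentOn F₁ F₂ Set.univ

end SurfaceCongruence

end

/-! Composing `F₁` with the rigid motion reduces the claim to embeddings that coincide on a nonempty
open set. The interior of the set where they coincide is open and nonempty; as `M` is connected, it
suffices that it is closed. So everything takes place in a chart, on a ball that contains a point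
near which both maps agree (`eqOn_of_planePrincipalCurvatures_eq`).

Both second fundamental forms satisfy the Codazzi equations of the same metric. These equations are
linear in the form, with Christoffel symbols determined by the metric, so the difference `(a, b, c)`
of the two forms satisfies them too. Equal principal curvatures give equal mean curvatures, hence
the difference is trace free. In isothermal coordinates it would be the real part of a holomorphic
quadratic differential, and would vanish identically as soon as it vanished on an open set.

Isothermal coordinates are avoided as follows. In a constant basis `(X, Y)` put `μ = φ + iψ` with `φ
= F/E` and `ψ = √(EG - F²)/E`. Being trace free means `c = (μ + μ̄) b - μμ̄ a`, and then `w = b - μ̄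
a` satisfies `|∂_Y w - μ ∂_X w| ≤ K |w|` with `K` locally bounded. Since `ψ ≠ 0` this inequality is
elliptic, and unique continuation follows from a Carleman inequality with weight `exp (τ exp (-λ
t))`, after a parabolic shear that makes the relevant support compact (`unique_continuation`).

Once the second fundamental forms agree, the frames `(df X, df Y, n)` of both maps solve the same
linear system along segments, with the same initial values, and Gronwall's inequality shows that the
maps agree (`eq_of_fundamental_forms_eq`). -/

noncomputable section

namespace SurfaceCongruence

/-! ### The Carleman inequality in the plane -/

section

open MeasureTheory

/-- The integral of a directional derivative of a compactly supported function vanishes. -/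
theorem integral_fderiv_apply_eq_zero {f : ℝ × ℝ → ℝ} (hf : ContDiff ℝ 1 f)
    (hc : HasCompactSupport f) (v : ℝ × ℝ) : ∫ p, fderiv ℝ f p v = 0 := by
  have h1 : Continuous fun p ↦ fderiv ℝ f p v :=
    (hf.continuous_fderiv one_ne_zero).clm_apply continuous_const
  have h2 : Integrable fun p ↦ fderiv ℝ f p v :=
    h1.integrable_of_hasCompactSupport (hc.fderiv_apply ℝ v)
  have h3 : Integrable f := hf.continuous.integrable_of_hasCompactSupport hc
  have := integral_mul_fderiv_eq_neg_fderiv_mul_of_integrable (μ := volume)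
    (f := fun _ : ℝ × ℝ ↦ (1 : ℝ)) (g := f) (v := v) (by simp) (by simpa using h2)
    (by simpa using h3) (by intros; fun_prop)
    (fun p _ ↦ (hf.differentiable one_ne_zero) p)
  simpa using this

theorem contDiff_fderiv_apply {f : ℝ × ℝ → ℝ} (hf : ContDiff ℝ 2 f) (v : ℝ × ℝ) :
    ContDiff ℝ 1 fun p ↦ fderiv ℝ f p v :=
  (hf.fderiv_right (m := 1) (by norm_num)).clm_apply contDiff_const

theorem fderiv_fderiv_comm {f : ℝ × ℝ → ℝ} (hf : ContDiff ℝ 2 f) (v w p : ℝ × ℝ) :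
    fderiv ℝ (fun p ↦ fderiv ℝ f p v) p w = fderiv ℝ (fun p ↦ fderiv ℝ f p w) p v := by
  have hd : DifferentiableAt ℝ (fderiv ℝ f) p :=
    ((hf.fderiv_right (m := 1) (by norm_num)).differentiable one_ne_zero) p
  have hs : IsSymmSndFDerivAt ℝ f p :=
    hf.contDiffAt.isSymmSndFDerivAt (by simp)
  rw [fderiv_clm_apply hd (differentiableAt_const _), fderiv_clm_apply hd (differentiableAt_const _)]
  simpa using hs w v

/-- Expand `|K + S|²` and keep the cross term on the left. Completing squares absorbs the `γ` term
into `|S|²` and the `βy` term into `|K|²`, each at the price of `C² |w|² / 4`; the two terms linear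
in `s` cost at most `2C|s| |w|²`. -/
theorem carleman_bound {γ βy αy s st x z K₁ K₂ S₁ S₂ C : ℝ} (h1 : |αy| ≤ C) (h2 : |βy| ≤ C)
    (h3 : |γ| ≤ C) :
    (st - 2 * C * |s| - C ^ 2) * (x ^ 2 + z ^ 2) + (2 * (K₁ * S₁ + K₂ * S₂) -
      (st + s * αy) * (x ^ 2 + z ^ 2) + (γ * (z * S₂ + x * S₁) + γ * s * (x ^ 2 + z ^ 2)
        + -βy * (z * K₁ - x * K₂))) ≤ (K₁ + S₁) ^ 2 + (K₂ + S₂) ^ 2 := by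
  have hr : 0 ≤ x ^ 2 + z ^ 2 := by positivity
  have q1 := mul_le_mul_of_nonneg_right (sq_le_sq' (abs_le.mp h3).1 (abs_le.mp h3).2) hr
  have q2 := mul_le_mul_of_nonneg_right (sq_le_sq' (abs_le.mp h2).1 (abs_le.mp h2).2) hr
  have b1 : γ * (z * S₂ + x * S₁) ≤ S₁ ^ 2 + S₂ ^ 2 + C ^ 2 * (x ^ 2 + z ^ 2) / 4 := by
    linarith [sq_nonneg (γ * z / 2 - S₂), sq_nonneg (γ * x / 2 - S₁)]
  have b2 : -βy * (z * K₁ - x * K₂) ≤ K₁ ^ 2 + K₂ ^ 2 + C ^ 2 * (x ^ 2 + z ^ 2) / 4 := by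
    linarith [sq_nonneg (βy * z / 2 + K₁), sq_nonneg (βy * x / 2 - K₂)]
  have b3 : γ * s ≤ C * |s| := (le_abs_self _).trans (by rw [abs_mul]; gcongr)
  have b4 : -(s * αy) ≤ C * |s| := (neg_le_abs _).trans (by rw [abs_mul, mul_comm]; gcongr)
  have b5 := mul_le_mul_of_nonneg_right (add_le_add b3 b4) hr
  have b6 : 0 ≤ C ^ 2 * (x ^ 2 + z ^ 2) := by positivity
  linarith

/-- Split the conjugated operator into `K = (∂ₜ + α ∂_y) w` and `S = iβ ∂_y w - s w`. The long
bracket is a divergence without its second derivatives, and equals `2⟨K, S⟩` up to lower order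
terms. Ellipticity enters through `βt + α βy = γ β`: the product `β (z xy - x zy)` is `⟨w, S⟩ + s
|w|²`, so it can be absorbed. -/
theorem carleman_algebra {α β s x z xt xy zt zy αy βt βy st C : ℝ} (hβ : β ≠ 0)
    (h1 : |αy| ≤ C) (h2 : |βy| ≤ C) (h3 : |βt + α * βy| ≤ C * |β|) :
    (st - 2 * C * |s| - C ^ 2) * (x ^ 2 + z ^ 2) +
      (-(st * (x ^ 2 + z ^ 2)) - s * (2 * x * xt + 2 * z * zt)
        - (s * αy * (x ^ 2 + z ^ 2) + s * α * (2 * x * xy + 2 * z * zy))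
        + βt * (z * xy - x * zy) - βy * (z * xt - x * zt)
        + 2 * β * (zt * xy - xt * zy)) ≤
    (xt + α * xy - β * zy - s * x) ^ 2 + (zt + α * zy + β * xy - s * z) ^ 2 := by
  obtain ⟨γ, hγ⟩ : ∃ γ, βt + α * βy = γ * β := ⟨(βt + α * βy) / β, by field_simp⟩
  have hγC : |γ| ≤ C := by
    rw [hγ, abs_mul] at h3
    exact le_of_mul_le_mul_right h3 (abs_pos.mpr hβ)
  have key := carleman_bound (s := s) (st := st) (x := x) (z := z) (K₁ := xt + α * xy)
    (K₂ := zt + α * zy) (S₁ := -β * zy - s * x) (S₂ := β * xy - s * z) h1 h2 hγC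
  have hβt : βt = γ * β - α * βy := by linarith
  subst hβt
  refine le_trans (le_of_eq ?_) (key.trans (le_of_eq ?_)) <;> ring

section

variable {α β s x z : ℝ × ℝ → ℝ}

/-- The `t`-component of the vector field whose divergence appears in the Carleman identity. -/
def fluxFst (β s x z : ℝ × ℝ → ℝ) (p : ℝ × ℝ) : ℝ :=
  -(s p * (x p ^ 2 + z p ^ 2)) +
    β p * (z p * fderiv ℝ x p (0, 1) - x p * fderiv ℝ z p (0, 1))

/-- The `y`-component of the vector field whose divergence appears in the Carleman identity. -/
def fluxSnd (α β s x z : ℝ × ℝ → ℝ) (p : ℝ × ℝ) : ℝ :=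
  -(s p * α p * (x p ^ 2 + z p ^ 2)) -
    β p * (z p * fderiv ℝ x p (1, 0) - x p * fderiv ℝ z p (1, 0))

theorem fderiv_fluxFst (hβ : ContDiff ℝ 1 β) (hs : ContDiff ℝ 1 s)
    (hx : ContDiff ℝ 2 x) (hz : ContDiff ℝ 2 z) (p : ℝ × ℝ) :
    fderiv ℝ (fluxFst β s x z) p (1, 0) =
      -(fderiv ℝ s p (1, 0) * (x p ^ 2 + z p ^ 2)) -
        s p * (2 * x p * fderiv ℝ x p (1, 0) + 2 * z p * fderiv ℝ z p (1, 0)) +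
      fderiv ℝ β p (1, 0) * (z p * fderiv ℝ x p (0, 1) - x p * fderiv ℝ z p (0, 1)) +
      β p * (fderiv ℝ z p (1, 0) * fderiv ℝ x p (0, 1) +
        z p * fderiv ℝ (fun p ↦ fderiv ℝ x p (0, 1)) p (1, 0) -
        fderiv ℝ x p (1, 0) * fderiv ℝ z p (0, 1) -
        x p * fderiv ℝ (fun p ↦ fderiv ℝ z p (0, 1)) p (1, 0)) := by
  have d1 := (hβ.differentiable one_ne_zero p).hasFDerivAt
  have d2 := (hs.differentiable one_ne_zero p).hasFDerivAt
  have d3 := (hx.differentiable two_ne_zero p).hasFDerivAt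
  have d4 := (hz.differentiable two_ne_zero p).hasFDerivAt
  have d5 := ((contDiff_fderiv_apply hx (0, 1)).differentiable one_ne_zero p).hasFDerivAt
  have d6 := ((contDiff_fderiv_apply hz (0, 1)).differentiable one_ne_zero p).hasFDerivAt
  have := (d2.mul ((d3.pow 2).add (d4.pow 2))).neg.add (d1.mul ((d4.mul d5).sub (d3.mul d6)))
  rw [show fderiv ℝ (fluxFst β s x z) p = _ from this.fderiv]
  simp
  ring

theorem fderiv_fluxSnd (hα : ContDiff ℝ 1 α) (hβ : ContDiff ℝ 1 β) (hs : ContDiff ℝ 1 s)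
    (hx : ContDiff ℝ 2 x) (hz : ContDiff ℝ 2 z) (p : ℝ × ℝ) :
    fderiv ℝ (fluxSnd α β s x z) p (0, 1) =
      -(fderiv ℝ s p (0, 1) * α p * (x p ^ 2 + z p ^ 2)) -
      (s p * fderiv ℝ α p (0, 1) * (x p ^ 2 + z p ^ 2) +
        s p * α p * (2 * x p * fderiv ℝ x p (0, 1) + 2 * z p * fderiv ℝ z p (0, 1))) -
      fderiv ℝ β p (0, 1) * (z p * fderiv ℝ x p (1, 0) - x p * fderiv ℝ z p (1, 0)) -
      β p * (fderiv ℝ z p (0, 1) * fderiv ℝ x p (1, 0) +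
        z p * fderiv ℝ (fun p ↦ fderiv ℝ x p (1, 0)) p (0, 1) -
        fderiv ℝ x p (0, 1) * fderiv ℝ z p (1, 0) -
        x p * fderiv ℝ (fun p ↦ fderiv ℝ z p (1, 0)) p (0, 1)) := by
  have d0 := (hα.differentiable one_ne_zero p).hasFDerivAt
  have d1 := (hβ.differentiable one_ne_zero p).hasFDerivAt
  have d2 := (hs.differentiable one_ne_zero p).hasFDerivAt
  have d3 := (hx.differentiable two_ne_zero p).hasFDerivAt
  have d4 := (hz.differentiable two_ne_zero p).hasFDerivAt
  have d5 := ((contDiff_fderiv_apply hx (1, 0)).differentiable one_ne_zero p).hasFDerivAt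
  have d6 := ((contDiff_fderiv_apply hz (1, 0)).differentiable one_ne_zero p).hasFDerivAt
  have := ((d2.mul d0).mul ((d3.pow 2).add (d4.pow 2))).neg.sub
    (d1.mul ((d4.mul d5).sub (d3.mul d6)))
  rw [show fderiv ℝ (fluxSnd α β s x z) p = _ from this.fderiv]
  simp
  ring

/-- The Carleman inequality for the conjugate `∂ₜ + (α + iβ) ∂_y - s` of a first order elliptic
operator in the plane, acting on `w = x + iz`. -/
theorem carleman_conjugated (hα : ContDiff ℝ 1 α) (hβ : ContDiff ℝ 1 β) (hs : ContDiff ℝ 1 s)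
    (hs0 : ∀ p, fderiv ℝ s p (0, 1) = 0) (hx : ContDiff ℝ 2 x) (hz : ContDiff ℝ 2 z)
    {𝒦 : Set (ℝ × ℝ)} (h𝒦 : IsCompact 𝒦) (hx𝒦 : tsupport x ⊆ 𝒦) (hz𝒦 : tsupport z ⊆ 𝒦)
    {C : ℝ} (hβ0 : ∀ p ∈ 𝒦, β p ≠ 0) (h1 : ∀ p ∈ 𝒦, |fderiv ℝ α p (0, 1)| ≤ C)
    (h2 : ∀ p ∈ 𝒦, |fderiv ℝ β p (0, 1)| ≤ C)
    (h3 : ∀ p ∈ 𝒦, |fderiv ℝ β p (1, 0) + α p * fderiv ℝ β p (0, 1)| ≤ C * |β p|) :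
    ∫ p, (fderiv ℝ s p (1, 0) - 2 * C * |s p| - C ^ 2) * (x p ^ 2 + z p ^ 2) ≤
      ∫ p, ((fderiv ℝ x p (1, 0) + α p * fderiv ℝ x p (0, 1) - β p * fderiv ℝ z p (0, 1) -
          s p * x p) ^ 2 +
        (fderiv ℝ z p (1, 0) + α p * fderiv ℝ z p (0, 1) + β p * fderiv ℝ x p (0, 1) -
          s p * z p) ^ 2) := by
  have x0 : ∀ p ∉ 𝒦, x p = 0 := fun p hp ↦ image_eq_zero_of_notMem_tsupport fun h ↦ hp (hx𝒦 h)
  have z0 : ∀ p ∉ 𝒦, z p = 0 := fun p hp ↦ image_eq_zero_of_notMem_tsupport fun h ↦ hp (hz𝒦 h)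
  have dx0 : ∀ p ∉ 𝒦, fderiv ℝ x p = 0 := fun p hp ↦
    fderiv_of_notMem_tsupport ℝ fun h ↦ hp (hx𝒦 h)
  have dz0 : ∀ p ∉ 𝒦, fderiv ℝ z p = 0 := fun p hp ↦
    fderiv_of_notMem_tsupport ℝ fun h ↦ hp (hz𝒦 h)
  have cα := hα.continuous
  have cβ := hβ.continuous
  have cs := hs.continuous
  have cx := hx.continuous
  have cz := hz.continuous
  have c1 := contDiff_fderiv_apply hx (1, 0)
  have c2 := contDiff_fderiv_apply hx (0, 1)
  have c3 := contDiff_fderiv_apply hz (1, 0)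
  have c4 := contDiff_fderiv_apply hz (0, 1)
  have c1' := c1.continuous
  have c2' := c2.continuous
  have c3' := c3.continuous
  have c4' := c4.continuous
  have cst : Continuous fun p ↦ fderiv ℝ s p (1, 0) :=
    (hs.continuous_fderiv one_ne_zero).clm_apply continuous_const
  have hx1 : ContDiff ℝ 1 x := hx.of_le (by norm_num)
  have hz1 : ContDiff ℝ 1 z := hz.of_le (by norm_num)
  have G1 : ContDiff ℝ 1 (fluxFst β s x z) := by unfold fluxFst; fun_prop
  have G2 : ContDiff ℝ 1 (fluxSnd α β s x z) := by unfold fluxSnd; fun_prop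
  have G1c : HasCompactSupport (fluxFst β s x z) :=
    HasCompactSupport.intro h𝒦 fun p hp ↦ by simp [fluxFst, x0 p hp, z0 p hp]
  have G2c : HasCompactSupport (fluxSnd α β s x z) :=
    HasCompactSupport.intro h𝒦 fun p hp ↦ by simp [fluxSnd, x0 p hp, z0 p hp]
  have I1 := integral_fderiv_apply_eq_zero G1 G1c (1, 0)
  have I2 := integral_fderiv_apply_eq_zero G2 G2c (0, 1)
  have J1 : Integrable fun p ↦ fderiv ℝ (fluxFst β s x z) p (1, 0) :=
    ((G1.continuous_fderiv one_ne_zero).clm_apply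
      continuous_const).integrable_of_hasCompactSupport (G1c.fderiv_apply ℝ _)
  have J2 : Integrable fun p ↦ fderiv ℝ (fluxSnd α β s x z) p (0, 1) :=
    ((G2.continuous_fderiv one_ne_zero).clm_apply
      continuous_const).integrable_of_hasCompactSupport (G2c.fderiv_apply ℝ _)
  have J3 : Integrable fun p ↦
      (fderiv ℝ s p (1, 0) - 2 * C * |s p| - C ^ 2) * (x p ^ 2 + z p ^ 2) := by
    refine Continuous.integrable_of_hasCompactSupport (by fun_prop)
      (HasCompactSupport.intro h𝒦 fun p hp ↦ by simp [x0 p hp, z0 p hp])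
  have J4 : Integrable fun p ↦
      ((fderiv ℝ x p (1, 0) + α p * fderiv ℝ x p (0, 1) - β p * fderiv ℝ z p (0, 1) -
          s p * x p) ^ 2 +
        (fderiv ℝ z p (1, 0) + α p * fderiv ℝ z p (0, 1) + β p * fderiv ℝ x p (0, 1) -
          s p * z p) ^ 2) := by
    refine Continuous.integrable_of_hasCompactSupport (by fun_prop)
      (HasCompactSupport.intro h𝒦 fun p hp ↦ by simp [x0 p hp, z0 p hp, dx0 p hp, dz0 p hp])
  have key : ∀ p, (fderiv ℝ s p (1, 0) - 2 * C * |s p| - C ^ 2) * (x p ^ 2 + z p ^ 2) +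
      (fderiv ℝ (fluxFst β s x z) p (1, 0) + fderiv ℝ (fluxSnd α β s x z) p (0, 1)) ≤
      ((fderiv ℝ x p (1, 0) + α p * fderiv ℝ x p (0, 1) - β p * fderiv ℝ z p (0, 1) -
          s p * x p) ^ 2 +
        (fderiv ℝ z p (1, 0) + α p * fderiv ℝ z p (0, 1) + β p * fderiv ℝ x p (0, 1) -
          s p * z p) ^ 2) := by
    intro p
    -- Symmetry of second derivatives cancels the mixed terms between the two flux components; a
    -- pointwise first order inequality remains.
    rw [fderiv_fluxFst hβ hs hx hz, fderiv_fluxSnd hα hβ hs hx hz, hs0,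
      fderiv_fderiv_comm hx (0, 1), fderiv_fderiv_comm hz (0, 1)]
    by_cases hp : p ∈ 𝒦
    · refine le_trans (le_of_eq ?_) (carleman_algebra (hβ0 p hp) (h1 p hp) (h2 p hp) (h3 p hp)
        (st := fderiv ℝ s p (1, 0)))
      ring
    · simp [x0 p hp, z0 p hp, dx0 p hp, dz0 p hp]
  have := integral_mono (J3.add (J1.add J2)) J4 key
  rw [integral_add' J3 (J1.add J2), integral_add' J1 J2, I1, I2] at this
  simpa using this

end

theorem exists_uniform_bound {α β : ℝ × ℝ → ℝ} (hα : ContDiff ℝ 1 α) (hβ : ContDiff ℝ 1 β)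
    {𝒦 : Set (ℝ × ℝ)} (h𝒦 : IsCompact 𝒦) (hβ0 : ∀ p ∈ 𝒦, β p ≠ 0) :
    ∃ C, 0 ≤ C ∧ ∀ p ∈ 𝒦, |fderiv ℝ α p (0, 1)| ≤ C ∧ |fderiv ℝ β p (0, 1)| ≤ C ∧
      |fderiv ℝ β p (1, 0) + α p * fderiv ℝ β p (0, 1)| ≤ C * |β p| := by
  have c1 : Continuous fun p ↦ fderiv ℝ α p (0, 1) :=
    (hα.continuous_fderiv one_ne_zero).clm_apply continuous_const
  have c2 : Continuous fun p ↦ fderiv ℝ β p (0, 1) :=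
    (hβ.continuous_fderiv one_ne_zero).clm_apply continuous_const
  have c3 : Continuous fun p ↦ fderiv ℝ β p (1, 0) :=
    (hβ.continuous_fderiv one_ne_zero).clm_apply continuous_const
  have c4 := hα.continuous
  have c5 := hβ.continuous
  obtain ⟨C1, h1⟩ := h𝒦.exists_bound_of_continuousOn c1.continuousOn
  obtain ⟨C2, h2⟩ := h𝒦.exists_bound_of_continuousOn c2.continuousOn
  obtain ⟨C3, h3⟩ := h𝒦.exists_bound_of_continuousOn
    (f := fun p ↦ (fderiv ℝ β p (1, 0) + α p * fderiv ℝ β p (0, 1)) / β p)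
    ((c3.add (c4.mul c2)).continuousOn.div c5.continuousOn hβ0)
  refine ⟨max 0 (max C1 (max C2 C3)), le_max_left _ _, fun p hp ↦ ⟨?_, ?_, ?_⟩⟩
  · exact (h1 p hp).trans (by simp)
  · exact (h2 p hp).trans (by simp)
  · have := h3 p hp
    rw [Real.norm_eq_abs, abs_div, div_le_iff₀ (abs_pos.mpr (hβ0 p hp))] at this
    exact this.trans (mul_le_mul_of_nonneg_right (by simp) (abs_nonneg _))

/-- The real and the imaginary part of `(∂ₜ + (α + iβ) ∂_y) (x + iz)`, squared and added. -/
def operatorSq (α β x z : ℝ × ℝ → ℝ) (p : ℝ × ℝ) : ℝ :=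
  (fderiv ℝ x p (1, 0) + α p * fderiv ℝ x p (0, 1) - β p * fderiv ℝ z p (0, 1)) ^ 2 +
    (fderiv ℝ z p (1, 0) + α p * fderiv ℝ z p (0, 1) + β p * fderiv ℝ x p (0, 1)) ^ 2

section

variable {α β x z : ℝ × ℝ → ℝ}

theorem continuous_operatorSq (hα : ContDiff ℝ 1 α) (hβ : ContDiff ℝ 1 β) (hx : ContDiff ℝ 2 x)
    (hz : ContDiff ℝ 2 z) : Continuous (operatorSq α β x z) := by
  have cα := hα.continuous
  have cβ := hβ.continuous
  have c1' := (contDiff_fderiv_apply hx (1, 0)).continuous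
  have c2' := (contDiff_fderiv_apply hx (0, 1)).continuous
  have c3' := (contDiff_fderiv_apply hz (1, 0)).continuous
  have c4' := (contDiff_fderiv_apply hz (0, 1)).continuous
  unfold operatorSq
  fun_prop

/-- The weight `exp (τ exp (-λ t))`. -/
def weight (τ l : ℝ) (p : ℝ × ℝ) : ℝ := Real.exp (τ * Real.exp (-(l * p.1)))

theorem contDiff_weight (τ l : ℝ) {n : WithTop ℕ∞} : ContDiff ℝ n (weight τ l) := by
  unfold weight
  fun_prop

theorem fderiv_weight (τ l : ℝ) (p v : ℝ × ℝ) :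
    fderiv ℝ (weight τ l) p v = -(τ * l * Real.exp (-(l * p.1))) * weight τ l p * v.1 := by
  have h1 : HasFDerivAt (fun p : ℝ × ℝ ↦ -(l * p.1)) _ p :=
    ((hasFDerivAt_fst (𝕜 := ℝ) (p := p)).const_mul l).neg
  have h2 := ((h1.exp).const_mul τ).exp
  rw [show fderiv ℝ (weight τ l) p = _ from h2.fderiv]
  simp [weight]
  ring

theorem fderiv_weightExponent (c l : ℝ) (p v : ℝ × ℝ) :
    fderiv ℝ (fun p : ℝ × ℝ ↦ -(c * Real.exp (-(l * p.1)))) p v =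
      c * l * Real.exp (-(l * p.1)) * v.1 := by
  have h1 : HasFDerivAt (fun p : ℝ × ℝ ↦ -(l * p.1)) _ p :=
    ((hasFDerivAt_fst (𝕜 := ℝ) (p := p)).const_mul l).neg
  have h2 := ((h1.exp).const_mul c).neg
  rw [show fderiv ℝ (fun p : ℝ × ℝ ↦ -(c * Real.exp (-(l * p.1)))) p = _ from h2.fderiv]
  simp
  ring

/-- The Carleman inequality for the elliptic operator `∂ₜ + (α + iβ) ∂_y`. -/
theorem carleman (hα : ContDiff ℝ 1 α) (hβ : ContDiff ℝ 1 β) (hx : ContDiff ℝ 2 x)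
    (hz : ContDiff ℝ 2 z) {𝒦 : Set (ℝ × ℝ)} (h𝒦 : IsCompact 𝒦) (hx𝒦 : tsupport x ⊆ 𝒦)
    (hz𝒦 : tsupport z ⊆ 𝒦) {C : ℝ} (hC : 0 ≤ C) (hβ0 : ∀ p ∈ 𝒦, β p ≠ 0)
    (h1 : ∀ p ∈ 𝒦, |fderiv ℝ α p (0, 1)| ≤ C) (h2 : ∀ p ∈ 𝒦, |fderiv ℝ β p (0, 1)| ≤ C)
    (h3 : ∀ p ∈ 𝒦, |fderiv ℝ β p (1, 0) + α p * fderiv ℝ β p (0, 1)| ≤ C * |β p|)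
    {τ : ℝ} (hτ : 0 ≤ τ) :
    ∫ p, (τ * (2 * C + 1) * Real.exp (-((2 * C + 1) * p.1)) - C ^ 2) *
        (weight τ (2 * C + 1) p ^ 2 * (x p ^ 2 + z p ^ 2)) ≤
      ∫ p, weight τ (2 * C + 1) p ^ 2 * operatorSq α β x z p := by
  set l := 2 * C + 1 with hl
  have hw : ContDiff ℝ 2 (weight τ l) := contDiff_weight τ l
  -- This `s` is the logarithmic `t`-derivative of the weight, so multiplication by the weight turns
  -- the operator into its conjugate. Here `∂ₜ s = l |s|`, and the choice `l = 2 * C + 1` leaves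
  -- exactly `|s| - C²` as the coefficient in `carleman_conjugated`.
  have key := carleman_conjugated (s := fun p ↦ -(τ * l * Real.exp (-(l * p.1))))
    (x := fun p ↦ weight τ l p * x p) (z := fun p ↦ weight τ l p * z p) hα hβ (by fun_prop)
    (fun p ↦ by rw [fderiv_weightExponent]; simp) (hw.mul hx) (hw.mul hz) h𝒦
    ((tsupport_mul_subset_right).trans hx𝒦) ((tsupport_mul_subset_right).trans hz𝒦) hβ0 h1 h2 h3
  have dw := fun p ↦ hw.differentiable two_ne_zero p
  have dx : ∀ p v, fderiv ℝ (fun p ↦ weight τ l p * x p) p v =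
      weight τ l p * fderiv ℝ x p v - (τ * l * Real.exp (-(l * p.1))) * weight τ l p * v.1 * x p := by
    intro p v
    rw [fderiv_fun_mul (dw p) (hx.differentiable two_ne_zero p)]
    simp [fderiv_weight]
    ring
  have dz : ∀ p v, fderiv ℝ (fun p ↦ weight τ l p * z p) p v =
      weight τ l p * fderiv ℝ z p v - (τ * l * Real.exp (-(l * p.1))) * weight τ l p * v.1 * z p := by
    intro p v
    rw [fderiv_fun_mul (dw p) (hz.differentiable two_ne_zero p)]
    simp [fderiv_weight]
    ring
  simp only [dx, dz, fderiv_weightExponent] at key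
  refine le_trans (le_of_eq ?_) (key.trans (le_of_eq ?_))
  · congr 1
    ext p
    have : 0 ≤ τ * l * Real.exp (-(l * p.1)) := by positivity
    rw [abs_neg, abs_of_nonneg this, hl]
    ring
  · congr 1
    ext p
    unfold operatorSq
    ring

/-- A compactly supported function satisfying `|(∂ₜ + (α + iβ) ∂_y) u| ≤ M |u|` for `t ≤ T` vanishes
for `t < T`. -/
theorem eq_zero_of_operatorSq_le (hα : ContDiff ℝ 1 α) (hβ : ContDiff ℝ 1 β) (hx : ContDiff ℝ 2 x)
    (hz : ContDiff ℝ 2 z) {𝒦 : Set (ℝ × ℝ)} (h𝒦 : IsCompact 𝒦) (hx𝒦 : tsupport x ⊆ 𝒦)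
    (hz𝒦 : tsupport z ⊆ 𝒦) (hβ0 : ∀ p ∈ 𝒦, β p ≠ 0) {M T : ℝ} (hM : 0 ≤ M)
    (hL : ∀ p, p.1 ≤ T → operatorSq α β x z p ≤ M * (x p ^ 2 + z p ^ 2)) {p : ℝ × ℝ}
    (hp : p.1 < T) : x p = 0 ∧ z p = 0 := by
  obtain ⟨C, hC, hbd⟩ := exists_uniform_bound hα hβ h𝒦 hβ0
  set l := 2 * C + 1 with hl
  have hl0 : 0 < l := by positivity
  obtain ⟨m, hm, hmle⟩ : ∃ m, 0 < m ∧ ∀ p ∈ 𝒦, m ≤ Real.exp (-(l * p.1)) := by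
    obtain ⟨B, hB⟩ := h𝒦.exists_bound_of_continuousOn
      (f := fun p : ℝ × ℝ ↦ p.1) continuous_fst.continuousOn
    refine ⟨Real.exp (-(l * B)), Real.exp_pos _, fun p hp ↦ Real.exp_le_exp.mpr ?_⟩
    have := (le_abs_self _).trans (hB p hp)
    nlinarith
  have x0 : ∀ p ∉ 𝒦, x p = 0 := fun p hp ↦ image_eq_zero_of_notMem_tsupport fun h ↦ hp (hx𝒦 h)
  have z0 : ∀ p ∉ 𝒦, z p = 0 := fun p hp ↦ image_eq_zero_of_notMem_tsupport fun h ↦ hp (hz𝒦 h)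
  have dx0 : ∀ p ∉ 𝒦, fderiv ℝ x p = 0 := fun p hp ↦
    fderiv_of_notMem_tsupport ℝ fun h ↦ hp (hx𝒦 h)
  have dz0 : ∀ p ∉ 𝒦, fderiv ℝ z p = 0 := fun p hp ↦
    fderiv_of_notMem_tsupport ℝ fun h ↦ hp (hz𝒦 h)
  have cx := hx.continuous
  have cz := hz.continuous
  have cQ := continuous_operatorSq hα hβ hx hz
  have Q0 : ∀ p ∉ 𝒦, operatorSq α β x z p = 0 := fun p hp ↦ by
    simp [operatorSq, dx0 p hp, dz0 p hp]
  have Qnn : ∀ p, 0 ≤ operatorSq α β x z p := fun p ↦ by unfold operatorSq; positivity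
  -- The factor `min 1 (max 0 (T - t))` is a continuous substitute for the indicator of `t < T`, so
  -- that a zero integral of `R` forces pointwise vanishing there.
  set R : ℝ × ℝ → ℝ := fun p ↦ (x p ^ 2 + z p ^ 2) * min 1 (max 0 (T - p.1)) with hR
  have cR : Continuous R := by fun_prop
  have R0 : ∀ p ∉ 𝒦, R p = 0 := fun p hp ↦ by simp [hR, x0 p hp, z0 p hp]
  have Rnn : ∀ p, 0 ≤ R p := fun p ↦ by
    have : 0 ≤ min 1 (max 0 (T - p.1)) := by simp
    positivity
  have Rc : HasCompactSupport R := HasCompactSupport.intro h𝒦 R0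
  have Qc : HasCompactSupport (operatorSq α β x z) := HasCompactSupport.intro h𝒦 Q0
  have IR := cR.integrable_of_hasCompactSupport Rc (μ := volume)
  have IQ := cQ.integrable_of_hasCompactSupport Qc (μ := volume)
  have main : ∀ τ, 0 ≤ τ → C ^ 2 + M ≤ τ * l * m →
      (τ * l * m - C ^ 2 - M) * ∫ p, R p ≤ ∫ p, operatorSq α β x z p := by
    intro τ hτ hτ2
    have h := carleman hα hβ hx hz h𝒦 hx𝒦 hz𝒦 hC hβ0 (fun p hp ↦ (hbd p hp).1)
      (fun p hp ↦ (hbd p hp).2.1) (fun p hp ↦ (hbd p hp).2.2) hτ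
    rw [← hl] at h
    have cw : Continuous (weight τ l) := (contDiff_weight τ l (n := 0)).continuous
    have mono : ∀ p q : ℝ × ℝ, p.1 ≤ q.1 → weight τ l q ^ 2 ≤ weight τ l p ^ 2 := by
      intro p q hpq
      unfold weight
      gcongr
    have wpos : ∀ p, 0 < weight τ l p ^ 2 := fun p ↦ by unfold weight; positivity
    set W := weight τ l (T, 0) ^ 2 with hW
    have I1 : Integrable fun p ↦ (τ * l * Real.exp (-(l * p.1)) - C ^ 2) *
        (weight τ l p ^ 2 * (x p ^ 2 + z p ^ 2)) :=
      Continuous.integrable_of_hasCompactSupport (by fun_prop)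
        (HasCompactSupport.intro h𝒦 fun p hp ↦ by simp [x0 p hp, z0 p hp])
    have I2 : Integrable fun p ↦ weight τ l p ^ 2 * operatorSq α β x z p :=
      Continuous.integrable_of_hasCompactSupport (by fun_prop)
        (HasCompactSupport.intro h𝒦 fun p hp ↦ by simp [Q0 p hp])
    have I3 : Integrable fun p ↦ M * (weight τ l p ^ 2 * (x p ^ 2 + z p ^ 2)) :=
      Continuous.integrable_of_hasCompactSupport (by fun_prop)
        (HasCompactSupport.intro h𝒦 fun p hp ↦ by simp [x0 p hp, z0 p hp])
    -- The differential inequality is available only for `t ≤ T`; beyond `T` the decreasing weight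
    -- is at most its value at `T`. Dividing by `W` at the end leaves a right-hand side independent
    -- of `τ`.
    have e1 : ∀ p, weight τ l p ^ 2 * operatorSq α β x z p ≤
        M * (weight τ l p ^ 2 * (x p ^ 2 + z p ^ 2)) + W * operatorSq α β x z p := by
      intro p
      rcases le_total p.1 T with hpT | hpT
      · have := mul_le_mul_of_nonneg_left (hL p hpT) (wpos p).le
        have := mul_nonneg (wpos (T, 0)).le (Qnn p)
        linarith
      · have := mul_le_mul_of_nonneg_right (mono (T, 0) p hpT) (Qnn p)
        have : 0 ≤ M * (weight τ l p ^ 2 * (x p ^ 2 + z p ^ 2)) := by positivity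
        linarith
    have e2 := integral_mono I2 (I3.add (IQ.const_mul W)) e1
    rw [integral_add' I3 (IQ.const_mul W), integral_const_mul W] at e2
    have e3 : ∀ p, W * ((τ * l * m - C ^ 2 - M) * R p) ≤
        (τ * l * Real.exp (-(l * p.1)) - C ^ 2) * (weight τ l p ^ 2 * (x p ^ 2 + z p ^ 2)) -
          M * (weight τ l p ^ 2 * (x p ^ 2 + z p ^ 2)) := by
      intro p
      by_cases hp : p ∈ 𝒦
      · have a1 : W * R p ≤ weight τ l p ^ 2 * (x p ^ 2 + z p ^ 2) := by
          rcases le_total p.1 T with hpT | hpT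
          · refine mul_le_mul (mono p (T, 0) hpT) ?_ (Rnn p) (wpos p).le
            exact mul_le_of_le_one_right (by positivity) (min_le_left _ _)
          · have : R p = 0 := by simp [hR, hpT]
            rw [this, mul_zero]
            positivity
        have a2 : τ * l * m - C ^ 2 - M ≤ τ * l * Real.exp (-(l * p.1)) - C ^ 2 - M := by
          have := mul_le_mul_of_nonneg_left (hmle p hp) (mul_nonneg hτ hl0.le)
          linarith
        have a3 : 0 ≤ τ * l * m - C ^ 2 - M := by linarith
        have a4 := mul_le_mul a2 a1 (mul_nonneg (wpos (T, 0)).le (Rnn p)) (a3.trans a2)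
        linarith
      · simp [R0 p hp, x0 p hp, z0 p hp]
    have e4 := integral_mono ((IR.const_mul _).const_mul W) (I1.sub I3) e3
    rw [integral_sub' I1 I3, integral_const_mul W, integral_const_mul] at e4
    refine le_of_mul_le_mul_left ?_ (wpos (T, 0))
    linarith
  have hR0 : ∫ p, R p ≤ 0 := by
    by_contra hpos
    push Not at hpos
    set A := ∫ p, operatorSq α β x z p with hA
    have hA0 : 0 ≤ A := integral_nonneg Qnn
    have hn : 0 ≤ C ^ 2 + M + (A + 1) / ∫ p, R p := by positivity
    -- With this `τ` the coefficient in `main` is `(A + 1) / ∫ R`, and `main` becomes `A + 1 ≤ A`.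
    have := main ((C ^ 2 + M + (A + 1) / ∫ p, R p) / (l * m)) (by positivity)
      (by
        have : (C ^ 2 + M + (A + 1) / ∫ p, R p) / (l * m) * l * m =
          C ^ 2 + M + (A + 1) / ∫ p, R p := by field_simp
        rw [this]
        have : 0 ≤ (A + 1) / ∫ p, R p := by positivity
        linarith)
    have e : (C ^ 2 + M + (A + 1) / ∫ p, R p) / (l * m) * l * m - C ^ 2 - M =
        (A + 1) / ∫ p, R p := by field_simp; ring
    rw [e, div_mul_cancel₀ _ hpos.ne'] at this
    linarith
  have hRp : R p = 0 := by
    by_contra hne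
    exact absurd (cR.integral_pos_of_hasCompactSupport_nonneg_nonzero Rc Rnn hne (μ := volume))
      (not_lt.mpr hR0)
  have hpos : 0 < min 1 (max 0 (T - p.1)) := by simp [hp]
  have : x p ^ 2 + z p ^ 2 = 0 := by
    rcases mul_eq_zero.mp hRp with h | h
    · exact h
    · exact absurd h hpos.ne'
  constructor <;> nlinarith [sq_nonneg (x p), sq_nonneg (z p)]

end

end

/-! ### Localisation of the vanishing theorem -/

open Topology Set

/-- A smooth cutoff equal to `1` near the closed set and to `0` near the complement of `U` extends
coefficients given only on `U`; the Carleman inequality asks for coefficients on the whole plane but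
uses their bounds on a compact set only. -/
theorem exists_contDiff_extension {f : ℝ × ℝ → ℝ} {U 𝒦 : Set (ℝ × ℝ)} {n : ℕ∞} (hU : IsOpen U)
    (hf : ContDiffOn ℝ n f U) (h𝒦 : IsClosed 𝒦) (hsub : 𝒦 ⊆ U) :
    ∃ g : ℝ × ℝ → ℝ, ContDiff ℝ n g ∧ ∀ p ∈ 𝒦, g p = f p := by
  obtain ⟨ψ, h0, h1, -⟩ := exists_contMDiffMap_zero_one_nhds_of_isClosed (n := n)
    𝓘(ℝ, ℝ × ℝ) hU.isClosed_compl h𝒦 (disjoint_compl_left_iff_subset.mpr hsub)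
  have hψ : ContDiff ℝ n ψ := ψ.contMDiff.contDiff
  refine ⟨fun p ↦ ψ p * f p, contDiff_iff_contDiffAt.mpr fun p ↦ ?_, fun p hp ↦ ?_⟩
  · by_cases hp : p ∈ U
    · exact hψ.contDiffAt.mul (hf.contDiffAt (hU.mem_nhds hp))
    · have : (fun p ↦ ψ p * f p) =ᶠ[𝓝 p] fun _ ↦ 0 := by
        filter_upwards [h0.filter_mono (nhds_le_nhdsSet hp)] with q hq
        simp [hq]
      exact contDiffAt_const.congr_of_eventuallyEq this
  · have : ψ p = 1 := (h1.filter_mono (nhds_le_nhdsSet hp)).self_of_nhds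
    simp [this]

theorem operatorSq_congr {α β α' β' x z x' z' : ℝ × ℝ → ℝ} {p : ℝ × ℝ} (hα : α p = α' p)
    (hβ : β p = β' p) (hx : x =ᶠ[𝓝 p] x') (hz : z =ᶠ[𝓝 p] z') :
    operatorSq α β x z p = operatorSq α' β' x' z' p := by
  simp only [operatorSq, hα, hβ, hx.fderiv_eq, hz.fderiv_eq]

/-- A solution of `|(∂ₜ + (α + iβ) ∂_y) u| ≤ M |u|` on an open set, whose support below a level
`T'` of `t` is compact, vanishes below each lower level. -/
theorem eq_zero_of_local_operatorSq_le {Ω 𝒦 : Set (ℝ × ℝ)} (hΩ : IsOpen Ω) (h𝒦 : IsCompact 𝒦)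
    (h𝒦Ω : 𝒦 ⊆ Ω) {α β x z M : ℝ × ℝ → ℝ} (hα : ContDiffOn ℝ 1 α Ω) (hβ : ContDiffOn ℝ 1 β Ω)
    (hx : ContDiffOn ℝ 2 x Ω) (hz : ContDiffOn ℝ 2 z Ω) (hM : ContinuousOn M Ω)
    (hβ0 : ∀ p ∈ Ω, β p ≠ 0)
    (hL : ∀ p ∈ Ω, operatorSq α β x z p ≤ M p * (x p ^ 2 + z p ^ 2)) {T T' : ℝ} (hT : T < T')
    (h0 : ∀ p ∈ Ω, p.1 ≤ T' → p ∉ 𝒦 → x p = 0 ∧ z p = 0) {p : ℝ × ℝ} (hpΩ : p ∈ Ω)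
    (hp : p.1 < T) : x p = 0 ∧ z p = 0 := by
  classical
  obtain ⟨a, ha, haeq⟩ := exists_contDiff_extension (n := 1) hΩ hα h𝒦.isClosed h𝒦Ω
  obtain ⟨b, hb, hbeq⟩ := exists_contDiff_extension (n := 1) hΩ hβ h𝒦.isClosed h𝒦Ω
  obtain ⟨M0, hM0⟩ := h𝒦.exists_bound_of_continuousOn (hM.mono h𝒦Ω)
  set T1 := (T + T') / 2 with hT1
  -- Cutting off between `T1` and `T'` yields compact support inside `𝒦` without changing the
  -- functions below `T1`, hence without changing the inequality for `t ≤ T < T1`.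
  set χ : ℝ × ℝ → ℝ := fun p ↦ Real.smoothTransition ((T' - p.1) / (T' - T1)) with hχ
  have hTT : 0 < T' - T1 := by rw [hT1]; linarith
  have χs : ContDiff ℝ 2 χ := Real.smoothTransition.contDiff.comp (by fun_prop)
  have χ1 : ∀ p : ℝ × ℝ, p.1 ≤ T1 → χ p = 1 := fun p hp ↦
    Real.smoothTransition.one_of_one_le (by rw [le_div_iff₀ hTT]; linarith)
  have χ0 : ∀ p : ℝ × ℝ, T' ≤ p.1 → χ p = 0 := fun p hp ↦
    Real.smoothTransition.zero_of_nonpos (by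
      rw [div_le_iff₀ hTT]; linarith)
  have supp : ∀ f : ℝ × ℝ → ℝ, (∀ p ∈ Ω, p.1 ≤ T' → p ∉ 𝒦 → f p = 0) →
      tsupport (Ω.indicator fun p ↦ χ p * f p) ⊆ 𝒦 := by
    intro f hf
    refine closure_minimal (fun p hp ↦ ?_) h𝒦.isClosed
    by_contra hp𝒦
    refine hp ?_
    by_cases hpΩ : p ∈ Ω
    · rw [indicator_of_mem hpΩ]
      rcases le_total p.1 T' with h | h
      · simp [hf p hpΩ h hp𝒦]
      · simp [χ0 p h]
    · exact indicator_of_notMem hpΩ _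
  have smooth : ∀ f : ℝ × ℝ → ℝ, (∀ p ∈ Ω, p.1 ≤ T' → p ∉ 𝒦 → f p = 0) → ContDiffOn ℝ 2 f Ω →
      ContDiff ℝ 2 (Ω.indicator fun p ↦ χ p * f p) := by
    intro f hf hfs
    refine contDiff_iff_contDiffAt.mpr fun p ↦ ?_
    by_cases hp : p ∈ tsupport (Ω.indicator fun p ↦ χ p * f p)
    swap
    · exact contDiffAt_const.congr_of_eventuallyEq (notMem_tsupport_iff_eventuallyEq.mp hp)
    have hpΩ := h𝒦Ω (supp f hf hp)
    refine (χs.contDiffAt.mul (hfs.contDiffAt (hΩ.mem_nhds hpΩ))).congr_of_eventuallyEq ?_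
    filter_upwards [hΩ.mem_nhds hpΩ] with q hq
    exact indicator_of_mem hq _
  have loc : ∀ f : ℝ × ℝ → ℝ, ∀ p ∈ Ω, p.1 < T1 →
      (Ω.indicator fun p ↦ χ p * f p) =ᶠ[𝓝 p] f := by
    intro f p hp hpT
    filter_upwards [hΩ.mem_nhds hp, (isOpen_lt continuous_fst continuous_const).mem_nhds hpT]
      with q hq hqT
    have hqT' : q.1 < T1 := hqT
    rw [indicator_of_mem hq, χ1 q hqT'.le, one_mul]
  have sx := supp x fun p h1 h2 h3 ↦ (h0 p h1 h2 h3).1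
  have sz := supp z fun p h1 h2 h3 ↦ (h0 p h1 h2 h3).2
  have TT1 : T < T1 := by rw [hT1]; linarith
  have := eq_zero_of_operatorSq_le ha hb (smooth x (fun p h1 h2 h3 ↦ (h0 p h1 h2 h3).1) hx)
    (smooth z (fun p h1 h2 h3 ↦ (h0 p h1 h2 h3).2) hz) h𝒦 sx sz
    (fun p hp ↦ by rw [hbeq p hp]; exact hβ0 p (h𝒦Ω hp)) (le_max_left 0 M0) (T := T) ?_ hp
  · rwa [(loc x p hpΩ (hp.trans TT1)).self_of_nhds,
      (loc z p hpΩ (hp.trans TT1)).self_of_nhds] at this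
  · intro q hqT
    by_cases hq : q ∈ 𝒦
    · have lx := loc x q (h𝒦Ω hq) (hqT.trans_lt TT1)
      have lz := loc z q (h𝒦Ω hq) (hqT.trans_lt TT1)
      rw [operatorSq_congr (haeq q hq) (hbeq q hq) lx lz, lx.self_of_nhds, lz.self_of_nhds]
      refine (hL q (h𝒦Ω hq)).trans (mul_le_mul_of_nonneg_right ?_ (by positivity))
      exact ((le_abs_self _).trans (hM0 q hq)).trans (le_max_right _ _)
    · have d1 := fderiv_of_notMem_tsupport ℝ fun h ↦ hq (sx h)
      have d2 := fderiv_of_notMem_tsupport ℝ fun h ↦ hq (sz h)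
      have : 0 ≤ max 0 M0 := le_max_left _ _
      rw [operatorSq, d1, d2]
      simp only [zero_apply]
      refine le_trans (le_of_eq (by ring)) (mul_nonneg this (by positivity))

/-! ### Unique continuation along a segment -/

section

variable {E : Type*} [NormedAddCommGroup E] [NormedSpace ℝ E]

/-- The map `(t, y) ↦ p + (t - K y²) Y + y X`. -/
def shear (p X Y : E) (K : ℝ) (r : ℝ × ℝ) : E := p + (r.1 - K * r.2 ^ 2) • Y + r.2 • X

theorem contDiff_shear (p X Y : E) (K : ℝ) {n : WithTop ℕ∞} : ContDiff ℝ n (shear p X Y K) := by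
  unfold shear
  fun_prop

theorem fderiv_shear (p X Y : E) (K : ℝ) (r v : ℝ × ℝ) :
    fderiv ℝ (shear p X Y K) r v = (v.1 - 2 * K * r.2 * v.2) • Y + v.2 • X := by
  have h1 := hasFDerivAt_fst (𝕜 := ℝ) (p := r)
  have h2 := hasFDerivAt_snd (𝕜 := ℝ) (p := r)
  have := (((h1.sub ((h2.pow 2).const_mul K)).smul_const Y).const_add p).add (h2.smul_const X)
  have h : HasFDerivAt (shear p X Y K) _ r := this
  rw [h.fderiv]
  simp
  module

theorem fderiv_comp_shear {p X Y : E} {K : ℝ} {f : E → ℝ} {r : ℝ × ℝ}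
    (hf : DifferentiableAt ℝ f (shear p X Y K r)) (v : ℝ × ℝ) :
    fderiv ℝ (fun r ↦ f (shear p X Y K r)) r v =
      (v.1 - 2 * K * r.2 * v.2) * fderiv ℝ f (shear p X Y K r) Y +
        v.2 * fderiv ℝ f (shear p X Y K r) X := by
  have h1 : DifferentiableAt ℝ (shear p X Y K) r :=
    (contDiff_shear p X Y K (n := 1)).differentiable one_ne_zero r
  have : fderiv ℝ (fun r ↦ f (shear p X Y K r)) r =
      (fderiv ℝ f (shear p X Y K r)).comp (fderiv ℝ (shear p X Y K) r) :=
    fderiv_comp r hf h1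
  rw [this, ContinuousLinearMap.comp_apply, fderiv_shear]
  simp

/-- In sheared coordinates `∂ₜ = ∂_Y` and `∂_y = ∂_X - k ∂_Y`. With `ω = α + iβ` this gives `∂_Y + ω
∂_X = (1 + kω) ∂ₜ + ω ∂_y`; dividing by `1 + kω` restores the normal form with coefficient `ω / (1 +
kω)`, and squared moduli are divided by `|1 + kω|²`. -/
theorem shear_algebra {α β k xX xY zX zY : ℝ} (hN : (1 + k * α) ^ 2 + (k * β) ^ 2 ≠ 0) :
    (xY + (α + k * (α ^ 2 + β ^ 2)) / ((1 + k * α) ^ 2 + (k * β) ^ 2) * (xX - k * xY) -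
      β / ((1 + k * α) ^ 2 + (k * β) ^ 2) * (zX - k * zY)) ^ 2 +
    (zY + (α + k * (α ^ 2 + β ^ 2)) / ((1 + k * α) ^ 2 + (k * β) ^ 2) * (zX - k * zY) +
      β / ((1 + k * α) ^ 2 + (k * β) ^ 2) * (xX - k * xY)) ^ 2 =
    ((xY + α * xX - β * zX) ^ 2 + (zY + α * zX + β * xX) ^ 2) /
      ((1 + k * α) ^ 2 + (k * β) ^ 2) := by
  have e : ∀ u v w : ℝ, ∀ a b : ℝ, ∀ N : ℝ, N ≠ 0 →
      u + a / N * v - b / N * w = (u * N + a * v - b * w) / N ∧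
      u + a / N * v + b / N * w = (u * N + a * v + b * w) / N := by
    intro u v w a b N hN
    constructor <;> field_simp
  rw [(e _ _ _ _ _ _ hN).1, (e _ _ _ _ _ _ hN).2, div_pow, div_pow, ← add_div,
    div_eq_div_iff (pow_ne_zero 2 hN) hN]
  ring

theorem shear_denominator_pos {α β k : ℝ} (hβ : β ≠ 0) : 0 < (1 + k * α) ^ 2 + (k * β) ^ 2 := by
  by_cases hk : k = 0
  · simp [hk]
  · have : k * β ≠ 0 := mul_ne_zero hk hβ
    positivity

/-- The segment from `p` to `p + Y` is compact and lies in `D` by convexity, so a thin tube around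
it, continued slightly beyond `p + Y`, stays in `D`; its start stays in `Z`. -/
theorem exists_tube {D Z : Set E} (hD : IsOpen D) (hc : Convex ℝ D) {p Y : E} (X : E) (hp : p ∈ D)
    (hpY : p + Y ∈ D) (hZ : Z ∈ 𝓝 p) :
    ∃ ε : ℝ, 0 < ε ∧ ε ≤ 1 ∧ (∀ s y : ℝ, 0 ≤ s → s ≤ 1 + ε → |y| ≤ ε → p + s • Y + y • X ∈ D) ∧
      ∀ s y : ℝ, |s| ≤ ε → |y| ≤ ε → p + s • Y + y • X ∈ Z := by
  set Ψ : ℝ × ℝ → E := fun r ↦ p + r.1 • Y + r.2 • X with hΨ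
  have cΨ : Continuous Ψ := by fun_prop
  have hsub : Icc (0 : ℝ) 1 ×ˢ {(0 : ℝ)} ⊆ Ψ ⁻¹' D := by
    rintro ⟨s, y⟩ ⟨hs, hy⟩
    simp only [mem_singleton_iff] at hy
    subst hy
    have := hc.add_smul_mem hp hpY hs
    simpa [hΨ] using this
  obtain ⟨δ, hδ, hδD⟩ := (isCompact_Icc.prod isCompact_singleton).exists_cthickening_subset_open
    (hD.preimage cΨ) hsub
  have hZ' : Ψ ⁻¹' Z ∈ 𝓝 ((0, 0) : ℝ × ℝ) := cΨ.continuousAt.preimage_mem_nhds (by simpa [hΨ])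
  obtain ⟨η, hη, hηZ⟩ := Metric.nhds_basis_closedBall.mem_iff.mp hZ'
  refine ⟨min 1 (min δ η), by positivity, min_le_left _ _, fun s y hs hs1 hy ↦ ?_,
    fun s y hs hy ↦ ?_⟩
  · refine show (s, y) ∈ Ψ ⁻¹' D from hδD (Metric.mem_cthickening_of_dist_le (s, y) (min s 1, 0) _ _ ?_ ?_)
    · simp [hs]
    · have h1 : min 1 (min δ η) ≤ δ := (min_le_right _ _).trans (min_le_left _ _)
      rw [Prod.dist_eq, max_le_iff]
      constructor
      · simp only [Real.dist_eq]
        rcases le_total s 1 with h | h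
        · simp [min_eq_left h, hδ.le]
        · rw [min_eq_right h, abs_of_nonneg (by linarith)]
          linarith
      · simpa using hy.trans h1
  · refine show (s, y) ∈ Ψ ⁻¹' Z from hηZ ?_
    have h1 : min 1 (min δ η) ≤ η := (min_le_right _ _).trans (min_le_right _ _)
    simp only [Metric.mem_closedBall, Prod.dist_eq, max_le_iff]
    exact ⟨by simpa using hs.trans h1, by simpa using hy.trans h1⟩

/-- Unique continuation along a segment for solutions `x + iz` of the elliptic inequality
`|(∂_Y + (α + iβ) ∂_X) (x + iz)|² ≤ M |x + iz|²`. -/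
theorem unique_continuation {D : Set E} (hD : IsOpen D) (hc : Convex ℝ D) {α β x z M : E → ℝ}
    (hα : ContDiffOn ℝ 1 α D) (hβ : ContDiffOn ℝ 1 β D) (hx : ContDiffOn ℝ 2 x D)
    (hz : ContDiffOn ℝ 2 z D) (hM : ContinuousOn M D) (hβ0 : ∀ p ∈ D, β p ≠ 0) {p X Y : E}
    (hL : ∀ p ∈ D, (fderiv ℝ x p Y + α p * fderiv ℝ x p X - β p * fderiv ℝ z p X) ^ 2 +
      (fderiv ℝ z p Y + α p * fderiv ℝ z p X + β p * fderiv ℝ x p X) ^ 2 ≤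
        M p * (x p ^ 2 + z p ^ 2))
    (hp : p ∈ D) (hpY : p + Y ∈ D) (h0 : ∀ᶠ q in 𝓝 p, x q = 0 ∧ z q = 0) :
    x (p + Y) = 0 ∧ z (p + Y) = 0 := by
  obtain ⟨ε, hε, hε1, hεD, hεZ⟩ := exists_tube hD hc X hp hpY h0
  -- On the part of the plane with `K y² ≤ t ≤ 1 + ε ≤ 2` this `K` forces `|y| ≤ ε`, so the
  -- parabolic region fits into the tube.
  set K := 4 / ε ^ 2 with hK
  have hK0 : 0 < K := by positivity
  have hy : ∀ r : ℝ × ℝ, 0 ≤ r.1 - K * r.2 ^ 2 → r.1 ≤ 1 + ε → |r.2| ≤ ε := by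
    intro r h1 h2
    have : K * r.2 ^ 2 ≤ 2 := by linarith
    rw [hK, div_mul_eq_mul_div, div_le_iff₀ (by positivity)] at this
    exact abs_le_of_sq_le_sq (by nlinarith) hε.le
  set Φ := shear p X Y K with hΦ
  set Ω : Set (ℝ × ℝ) := {r | 0 < r.1 - K * r.2 ^ 2 ∧ r.1 < 1 + ε} with hΩdef
  have cs : Continuous fun r : ℝ × ℝ ↦ r.1 - K * r.2 ^ 2 := by fun_prop
  have hΩ : IsOpen Ω := (isOpen_lt continuous_const cs).inter
    (isOpen_lt continuous_fst continuous_const)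
  have hΩD : ∀ r ∈ Ω, Φ r ∈ D := fun r hr ↦
    hεD _ _ hr.1.le (by have := hr.2; have : 0 ≤ K * r.2 ^ 2 := by positivity
                        linarith) (hy r hr.1.le hr.2.le)
  set 𝒦 : Set (ℝ × ℝ) := {r | ε / 2 ≤ r.1 - K * r.2 ^ 2 ∧ r.1 ≤ 1 + ε / 2} with h𝒦def
  have h𝒦 : IsCompact 𝒦 := by
    refine (isCompact_Icc.prod isCompact_Icc).of_isClosed_subset
      (s := Icc 0 (1 + ε) ×ˢ Icc (-ε) ε) ?_ ?_
    · exact (isClosed_le continuous_const cs).inter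
        (isClosed_le continuous_fst continuous_const)
    · rintro r ⟨h1, h2⟩
      have : 0 ≤ K * r.2 ^ 2 := by positivity
      exact ⟨⟨by linarith, by linarith⟩, abs_le.mp (hy r (by linarith) (by linarith))⟩
  have h𝒦Ω : 𝒦 ⊆ Ω := fun r ⟨h1, h2⟩ ↦ ⟨by linarith, by linarith⟩
  have cΦ : ∀ {n : WithTop ℕ∞}, ContDiff ℝ n Φ := contDiff_shear p X Y K
  set k : ℝ × ℝ → ℝ := fun r ↦ 2 * K * r.2 with hk
  set N : ℝ × ℝ → ℝ := fun r ↦ (1 + k r * α (Φ r)) ^ 2 + (k r * β (Φ r)) ^ 2 with hNdef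
  have hN : ∀ r ∈ Ω, 0 < N r := fun r hr ↦ shear_denominator_pos (hβ0 _ (hΩD r hr))
  have ck : ∀ {n : WithTop ℕ∞}, ContDiffOn ℝ n k Ω := by intro n; fun_prop
  have cα : ContDiffOn ℝ 1 (fun r ↦ α (Φ r)) Ω := hα.comp cΦ.contDiffOn hΩD
  have cβ : ContDiffOn ℝ 1 (fun r ↦ β (Φ r)) Ω := hβ.comp cΦ.contDiffOn hΩD
  have cN : ContDiffOn ℝ 1 N Ω :=
    ((contDiffOn_const.add (ck.mul cα)).pow 2).add ((ck.mul cβ).pow 2)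
  -- The endpoint `p + Y` has sheared coordinates `(1, 0)`, below `T = 1 + ε / 4`. Points of `Ω`
  -- with `t ≤ T'` outside `𝒦` have `t - K y² < ε / 2`; they are mapped close to `p`, where the
  -- functions vanish by assumption.
  have key := eq_zero_of_local_operatorSq_le hΩ h𝒦 h𝒦Ω (x := fun r ↦ x (Φ r))
    (z := fun r ↦ z (Φ r)) (M := fun r ↦ M (Φ r) / N r) (T := 1 + ε / 4) (T' := 1 + ε / 2)
    (p := (1, 0))
    (α := fun r ↦ (α (Φ r) + k r * (α (Φ r) ^ 2 + β (Φ r) ^ 2)) / N r)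
    (β := fun r ↦ β (Φ r) / N r)
    ((cα.add (ck.mul ((cα.pow 2).add (cβ.pow 2)))).div cN fun r hr ↦ (hN r hr).ne')
    (cβ.div cN fun r hr ↦ (hN r hr).ne')
    (hx.comp cΦ.contDiffOn hΩD) (hz.comp cΦ.contDiffOn hΩD)
    ((hM.comp (cΦ (n := 0)).continuous.continuousOn hΩD).div cN.continuousOn
      fun r hr ↦ (hN r hr).ne')
    (fun r hr ↦ div_ne_zero (hβ0 _ (hΩD r hr)) (hN r hr).ne') ?_ (by linarith) ?_
    (by simp [hΩdef, hε]) (by simp [hε])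
  · simpa [hΦ, shear] using key
  · intro r hr
    have hrD := hΩD r hr
    have dx : DifferentiableAt ℝ x (Φ r) :=
      (hx.contDiffAt (hD.mem_nhds hrD)).differentiableAt two_ne_zero
    have dz : DifferentiableAt ℝ z (Φ r) :=
      (hz.contDiffAt (hD.mem_nhds hrD)).differentiableAt two_ne_zero
    have e := shear_algebra (α := α (Φ r)) (β := β (Φ r)) (k := k r) (xX := fderiv ℝ x (Φ r) X)
      (xY := fderiv ℝ x (Φ r) Y) (zX := fderiv ℝ z (Φ r) X) (zY := fderiv ℝ z (Φ r) Y)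
      (hN r hr).ne'
    have e' : operatorSq (fun r ↦ (α (Φ r) + k r * (α (Φ r) ^ 2 + β (Φ r) ^ 2)) / N r)
        (fun r ↦ β (Φ r) / N r) (fun r ↦ x (Φ r)) (fun r ↦ z (Φ r)) r =
        ((fderiv ℝ x (Φ r) Y + α (Φ r) * fderiv ℝ x (Φ r) X -
          β (Φ r) * fderiv ℝ z (Φ r) X) ^ 2 + (fderiv ℝ z (Φ r) Y +
          α (Φ r) * fderiv ℝ z (Φ r) X + β (Φ r) * fderiv ℝ x (Φ r) X) ^ 2) / N r := by
      refine Eq.trans ?_ e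
      simp only [operatorSq, hΦ, fderiv_comp_shear dx, fderiv_comp_shear dz]
      simp only [hk, hNdef, hΦ]
      ring
    rw [e', div_mul_eq_mul_div]
    exact div_le_div_of_nonneg_right (hL _ hrD) (hN r hr).le
  · intro r hr hrT hr𝒦
    have h1 : r.1 - K * r.2 ^ 2 < ε / 2 := by
      by_contra h
      exact hr𝒦 ⟨not_lt.mp h, hrT⟩
    refine hεZ _ _ ?_ (hy r hr.1.le hr.2.le)
    rw [abs_of_pos hr.1]
    linarith

end

/-! ### Fundamental forms, Koszul formula and Codazzi equation -/

/-- Expansion of a vector of `ℝ³` in a frame `(u, v, n)` with `n` a unit normal of `u` and `v`. -/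
theorem frame_expansion {u v n : Space} (hnu : ⟪n, u⟫ = 0) (hnv : ⟪n, v⟫ = 0) (hn : ⟪n, n⟫ = 1)
    (hΔ : ⟪u, u⟫ * ⟪v, v⟫ - ⟪u, v⟫ ^ 2 ≠ 0) (w : Space) :
    w = ((⟪v, v⟫ * ⟪w, u⟫ - ⟪u, v⟫ * ⟪w, v⟫) / (⟪u, u⟫ * ⟪v, v⟫ - ⟪u, v⟫ ^ 2)) • u +
      ((⟪u, u⟫ * ⟪w, v⟫ - ⟪u, v⟫ * ⟪w, u⟫) / (⟪u, u⟫ * ⟪v, v⟫ - ⟪u, v⟫ ^ 2)) • v +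
      ⟪w, n⟫ • n := by
  have hli : LinearIndependent ℝ ![u, v, n] := by
    rw [Fintype.linearIndependent_iff]
    intro g hg
    rw [Fin.sum_univ_three] at hg
    simp only [Matrix.cons_val_zero, Matrix.cons_val_one, Matrix.cons_val] at hg
    have e0 := congrArg (fun x ↦ ⟪n, x⟫) hg
    have e1 := congrArg (fun x ↦ ⟪u, x⟫) hg
    have e2 := congrArg (fun x ↦ ⟪v, x⟫) hg
    simp only [inner_add_right, inner_smul_right, inner_zero_right, hnu, hnv, hn,
      real_inner_comm n u, real_inner_comm n v, real_inner_comm u v] at e0 e1 e2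
    have g0 : g 0 = 0 := (mul_eq_zero.mp (by linear_combination ⟪v, v⟫ * e1 - ⟪u, v⟫ * e2 :
      g 0 * (⟪u, u⟫ * ⟪v, v⟫ - ⟪u, v⟫ ^ 2) = 0)).resolve_right hΔ
    have g1 : g 1 = 0 := (mul_eq_zero.mp (by linear_combination ⟪u, u⟫ * e2 - ⟪u, v⟫ * e1 :
      g 1 * (⟪u, u⟫ * ⟪v, v⟫ - ⟪u, v⟫ ^ 2) = 0)).resolve_right hΔ
    intro i
    fin_cases i
    · exact g0
    · exact g1
    · simpa using e0
  have hspan := hli.span_eq_top_of_card_eq_finrank (by simp)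
  set w' := ((⟪v, v⟫ * ⟪w, u⟫ - ⟪u, v⟫ * ⟪w, v⟫) / (⟪u, u⟫ * ⟪v, v⟫ - ⟪u, v⟫ ^ 2)) • u +
      ((⟪u, u⟫ * ⟪w, v⟫ - ⟪u, v⟫ * ⟪w, u⟫) / (⟪u, u⟫ * ⟪v, v⟫ - ⟪u, v⟫ ^ 2)) • v +
      ⟪w, n⟫ • n with hw'
  have aux : ∀ e f g a b d : ℝ, d ≠ 0 → d = e * g - f ^ 2 →
      a - ((g * a - f * b) / d * e + (e * b - f * a) / d * f) = 0 := by
    intro e f g a b d hd h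
    field_simp
    rw [h]
    ring
  have h1 : ∀ i, ⟪w - w', ![u, v, n] i⟫ = 0 := by
    intro i
    fin_cases i
    · change ⟪w - w', u⟫ = 0
      simp only [hw', inner_sub_left, inner_add_left, real_inner_smul_left, hnu,
        real_inner_comm u v]
      linear_combination aux ⟪u, u⟫ ⟪u, v⟫ ⟪v, v⟫ ⟪w, u⟫ ⟪w, v⟫ _ hΔ rfl
    · change ⟪w - w', v⟫ = 0
      simp only [hw', inner_sub_left, inner_add_left, real_inner_smul_left, hnv]
      linear_combination aux ⟪v, v⟫ ⟪u, v⟫ ⟪u, u⟫ ⟪w, v⟫ ⟪w, u⟫ _ hΔ (by ring)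
    · change ⟪w - w', n⟫ = 0
      simp only [hw', inner_sub_left, inner_add_left, real_inner_smul_left, hn,
        real_inner_comm n u, real_inner_comm n v, hnu, hnv]
      ring
  have h2 : ∀ x ∈ Submodule.span ℝ (range ![u, v, n]), ⟪w - w', x⟫ = 0 := by
    intro x hx
    induction hx using Submodule.span_induction with
    | mem x hx => obtain ⟨i, rfl⟩ := hx; exact h1 i
    | zero => simp
    | add x y _ _ hx hy => rw [inner_add_right, hx, hy, add_zero]
    | smul a x _ hx => rw [inner_smul_right, hx, mul_zero]
  have h3 := h2 (w - w') (by rw [hspan]; trivial)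
  exact sub_eq_zero.mp (inner_self_eq_zero.mp h3)

section

variable {E : Type*} [NormedAddCommGroup E] [NormedSpace ℝ E] {D : Set E} {f n h m : E → Space}

theorem contDiffOn_fderiv_apply {F : Type*} [NormedAddCommGroup F] [NormedSpace ℝ F] {f : E → F}
    (hD : IsOpen D) (hf : ContDiffOn ℝ ∞ f D) (v : E) :
    ContDiffOn ℝ ∞ (fun p ↦ fderiv ℝ f p v) D :=
  (hf.fderiv_of_isOpen (m := ∞) hD (by simp)).clm_apply contDiffOn_const

theorem _root_.ContDiffOn.differentiableAt_of_isOpen {F : Type*} [NormedAddCommGroup F]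
    [NormedSpace ℝ F] {f : E → F} (hf : ContDiffOn ℝ ∞ f D) (hD : IsOpen D) {p : E} (hp : p ∈ D) :
    DifferentiableAt ℝ f p :=
  (hf.contDiffAt (hD.mem_nhds hp)).differentiableAt (by simp)

/-- The second derivative of `f` in the directions of the constant fields `v` and `w`. -/
def secondDeriv {F : Type*} [NormedAddCommGroup F] [NormedSpace ℝ F] (f : E → F) (p v w : E) : F :=
  fderiv ℝ (fun q ↦ fderiv ℝ f q w) p v

theorem secondDeriv_comm {F : Type*} [NormedAddCommGroup F] [NormedSpace ℝ F] {f : E → F}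
    (hD : IsOpen D) (hf : ContDiffOn ℝ ∞ f D) {p : E} (hp : p ∈ D) (v w : E) :
    secondDeriv f p v w = secondDeriv f p w v := by
  have hc := hf.contDiffAt (hD.mem_nhds hp)
  have hd : DifferentiableAt ℝ (fderiv ℝ f) p :=
    (hc.fderiv_right (m := 1) (by norm_cast)).differentiableAt one_ne_zero
  have hs : IsSymmSndFDerivAt ℝ f p := hc.isSymmSndFDerivAt
    (by rw [minSmoothness_of_isRCLikeNormedField]; norm_cast)
  unfold secondDeriv
  rw [fderiv_clm_apply hd (differentiableAt_const _), fderiv_clm_apply hd (differentiableAt_const _)]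
  simpa using hs v w

/-- `n` is a smooth unit normal field of the smooth map `f : D → ℝ³`. -/
structure IsNormalField (D : Set E) (f n : E → Space) : Prop where
  smooth : ContDiffOn ℝ ∞ f D
  smooth_normal : ContDiffOn ℝ ∞ n D
  inner_fderiv : ∀ p ∈ D, ∀ v, ⟪n p, fderiv ℝ f p v⟫ = 0
  inner_self : ∀ p ∈ D, ⟪n p, n p⟫ = 1

/-- The second fundamental form of `f` with respect to the normal field `n`. -/
def secondForm (f n : E → Space) (p v w : E) : ℝ := -⟪fderiv ℝ n p v, fderiv ℝ f p w⟫

theorem contDiffOn_secondForm (hD : IsOpen D) (hf : IsNormalField D f n) (v w : E) :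
    ContDiffOn ℝ ∞ (fun p ↦ secondForm f n p v w) D :=
  ((contDiffOn_fderiv_apply hD hf.smooth_normal v).inner ℝ
    (contDiffOn_fderiv_apply hD hf.smooth w)).neg

theorem fderiv_inner_fderiv (hD : IsOpen D) (hf : ContDiffOn ℝ ∞ f D) {p : E} (hp : p ∈ D)
    (v w z : E) : fderiv ℝ (fun q ↦ ⟪fderiv ℝ f q w, fderiv ℝ f q z⟫) p v =
      ⟪secondDeriv f p v w, fderiv ℝ f p z⟫ + ⟪secondDeriv f p v z, fderiv ℝ f p w⟫ := by
  rw [fderiv_inner_apply ℝ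
    ((contDiffOn_fderiv_apply hD hf w).differentiableAt_of_isOpen hD hp)
    ((contDiffOn_fderiv_apply hD hf z).differentiableAt_of_isOpen hD hp), real_inner_comm, add_comm]
  rfl

/-- The Koszul formula. -/
theorem koszul (hD : IsOpen D) (hf : ContDiffOn ℝ ∞ f D) {p : E} (hp : p ∈ D) (v w z : E) :
    ⟪secondDeriv f p v w, fderiv ℝ f p z⟫ =
      (fderiv ℝ (fun q ↦ ⟪fderiv ℝ f q w, fderiv ℝ f q z⟫) p v +
        fderiv ℝ (fun q ↦ ⟪fderiv ℝ f q v, fderiv ℝ f q z⟫) p w -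
        fderiv ℝ (fun q ↦ ⟪fderiv ℝ f q v, fderiv ℝ f q w⟫) p z) / 2 := by
  simp only [fderiv_inner_fderiv hD hf hp]
  rw [secondDeriv_comm hD hf hp w v, secondDeriv_comm hD hf hp z v, secondDeriv_comm hD hf hp z w]
  ring

/-- By the Koszul formula the tangential parts of second derivatives, that is the Christoffel
symbols, depend only on the metric. -/
theorem inner_secondDeriv_eq_of_isometric (hD : IsOpen D) (hf : ContDiffOn ℝ ∞ f D)
    (hh : ContDiffOn ℝ ∞ h D)
    (hg : ∀ p ∈ D, ∀ v w, ⟪fderiv ℝ f p v, fderiv ℝ f p w⟫ = ⟪fderiv ℝ h p v, fderiv ℝ h p w⟫)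
    {p : E} (hp : p ∈ D) (v w z : E) :
    ⟪secondDeriv f p v w, fderiv ℝ f p z⟫ = ⟪secondDeriv h p v w, fderiv ℝ h p z⟫ := by
  have : ∀ v w, (fun q ↦ ⟪fderiv ℝ f q v, fderiv ℝ f q w⟫) =ᶠ[𝓝 p]
      fun q ↦ ⟪fderiv ℝ h q v, fderiv ℝ h q w⟫ := by
    intro v w
    filter_upwards [hD.mem_nhds hp] with q hq using hg q hq v w
  rw [koszul hD hf hp, koszul hD hh hp, (this w z).fderiv_eq, (this v z).fderiv_eq,
    (this v w).fderiv_eq]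

/-- Differentiate `⟨n, ∂_w f⟩ = 0` in the direction `v`. -/
theorem inner_normal_secondDeriv (hD : IsOpen D) (hf : IsNormalField D f n) {p : E} (hp : p ∈ D)
    (v w : E) : ⟪secondDeriv f p v w, n p⟫ = secondForm f n p v w := by
  have h0 : (fun q ↦ ⟪n q, fderiv ℝ f q w⟫) =ᶠ[𝓝 p] fun _ ↦ 0 := by
    filter_upwards [hD.mem_nhds hp] with q hq using hf.inner_fderiv q hq w
  have h1 := congrArg (fun L : E →L[ℝ] ℝ ↦ L v) h0.fderiv_eq
  rw [fderiv_inner_apply ℝ (hf.smooth_normal.differentiableAt_of_isOpen hD hp)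
    ((contDiffOn_fderiv_apply hD hf.smooth w).differentiableAt_of_isOpen hD hp)] at h1
  simp only [fderiv_fun_const, Pi.zero_apply, zero_apply] at h1
  rw [secondForm, secondDeriv, real_inner_comm]
  linarith

theorem secondForm_comm (hD : IsOpen D) (hf : IsNormalField D f n) {p : E} (hp : p ∈ D)
    (v w : E) : secondForm f n p v w = secondForm f n p w v := by
  rw [← inner_normal_secondDeriv hD hf hp, ← inner_normal_secondDeriv hD hf hp,
    secondDeriv_comm hD hf.smooth hp]

theorem inner_fderiv_normal (hD : IsOpen D) (hf : IsNormalField D f n) {p : E} (hp : p ∈ D)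
    (v : E) : ⟪fderiv ℝ n p v, n p⟫ = 0 := by
  have h0 : (fun q ↦ ⟪n q, n q⟫) =ᶠ[𝓝 p] fun _ ↦ 1 := by
    filter_upwards [hD.mem_nhds hp] with q hq using hf.inner_self q hq
  have h1 := congrArg (fun L : E →L[ℝ] ℝ ↦ L v) h0.fderiv_eq
  have hd := hf.smooth_normal.differentiableAt_of_isOpen hD hp
  rw [fderiv_inner_apply ℝ hd hd, real_inner_comm] at h1
  simp only [fderiv_fun_const, Pi.zero_apply, zero_apply] at h1
  linarith

/-- The Codazzi equation. -/
theorem codazzi (hD : IsOpen D) (hf : IsNormalField D f n) {p : E} (hp : p ∈ D) (v w z : E) :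
    fderiv ℝ (fun q ↦ secondForm f n q w z) p v - fderiv ℝ (fun q ↦ secondForm f n q v z) p w =
      ⟪fderiv ℝ n p v, secondDeriv f p w z⟫ - ⟪fderiv ℝ n p w, secondDeriv f p v z⟫ := by
  -- The product rule produces the second derivative of `n`, which is symmetric in `v`, `w` and
  -- disappears from the difference.
  have e : ∀ v w, fderiv ℝ (fun q ↦ secondForm f n q w z) p v =
      -(⟪fderiv ℝ n p w, secondDeriv f p v z⟫ + ⟪secondDeriv n p v w, fderiv ℝ f p z⟫) := by
    intro v w
    unfold secondForm
    rw [fderiv_fun_neg, neg_apply, fderiv_inner_apply ℝ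
      ((contDiffOn_fderiv_apply hD hf.smooth_normal w).differentiableAt_of_isOpen hD hp)
      ((contDiffOn_fderiv_apply hD hf.smooth z).differentiableAt_of_isOpen hD hp)]
    rfl
  rw [e, e, secondDeriv_comm hD hf.smooth_normal hp w v]
  ring

end

/-! ### Unique continuation for trace free Codazzi tensors -/

section

variable {E : Type*} [NormedAddCommGroup E] [NormedSpace ℝ E] {D : Set E}

theorem sq_add_mul_le {r s x z : ℝ} : (r * x + s * z) ^ 2 ≤ (r ^ 2 + s ^ 2) * (x ^ 2 + z ^ 2) := by
  nlinarith [sq_nonneg (r * z - s * x)]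

/-- Unique continuation for trace free Codazzi tensors `(a, b, c)` on a surface: `φ` and `ψ` are the
coefficients of the conformal structure, and `P₁, Q₁, P₂, Q₂` collect the Christoffel symbols. -/
theorem codazzi_unique_continuation (hD : IsOpen D) (hc : Convex ℝ D)
    {a b c φ ψ P₁ Q₁ P₂ Q₂ : E → ℝ} (ha : ContDiffOn ℝ ∞ a D) (hb : ContDiffOn ℝ ∞ b D)
    (hφ : ContDiffOn ℝ ∞ φ D) (hψ : ContDiffOn ℝ ∞ ψ D) (hψ0 : ∀ p ∈ D, ψ p ≠ 0)
    (htr : ∀ p ∈ D, c p = 2 * φ p * b p - (φ p ^ 2 + ψ p ^ 2) * a p)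
    (hP₁ : ContinuousOn P₁ D) (hQ₁ : ContinuousOn Q₁ D) (hP₂ : ContinuousOn P₂ D)
    (hQ₂ : ContinuousOn Q₂ D) {p X Y : E}
    (h1 : ∀ q ∈ D, fderiv ℝ a q Y - fderiv ℝ b q X = P₁ q * a q + Q₁ q * b q)
    (h2 : ∀ q ∈ D, fderiv ℝ b q Y - fderiv ℝ c q X = P₂ q * a q + Q₂ q * b q)
    (hp : p ∈ D) (hpY : p + Y ∈ D) (h0 : ∀ᶠ q in 𝓝 p, a q = 0 ∧ b q = 0) :
    a (p + Y) = 0 ∧ b (p + Y) = 0 := by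
  set R₁ : E → ℝ := fun q ↦ -(φ q * fderiv ℝ φ q X + ψ q * fderiv ℝ ψ q X) - fderiv ℝ φ q Y +
    P₂ q - φ q * P₁ q with hR₁
  set R₂ : E → ℝ := fun q ↦ 2 * fderiv ℝ φ q X + Q₂ q - φ q * Q₁ q with hR₂
  set I₁ : E → ℝ := fun q ↦ fderiv ℝ ψ q Y - φ q * fderiv ℝ ψ q X + ψ q * fderiv ℝ φ q X +
    ψ q * P₁ q with hI₁
  set I₂ : E → ℝ := fun q ↦ ψ q * Q₁ q with hI₂
  have cφ := hφ.continuousOn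
  have cψ := hψ.continuousOn
  have cφX := (contDiffOn_fderiv_apply hD hφ X).continuousOn
  have cφY := (contDiffOn_fderiv_apply hD hφ Y).continuousOn
  have cψX := (contDiffOn_fderiv_apply hD hψ X).continuousOn
  have cψY := (contDiffOn_fderiv_apply hD hψ Y).continuousOn
  have cR₁ : ContinuousOn R₁ D := by fun_prop
  have cR₂ : ContinuousOn R₂ D := by fun_prop
  have cI₁ : ContinuousOn I₁ D := by fun_prop
  have cI₂ : ContinuousOn I₂ D := by fun_prop
  -- The unknown is `w = b - μ̄ a` with `μ = φ + iψ`. Modulo terms linear in `a` and `b`, `∂_Y w =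
  -- ∂_X c - μ̄ ∂_X b = μ ∂_X w`, because `c = (μ + μ̄) b - μμ̄ a`. The remainders `R₁ a + R₂ b` and
  -- `I₁ a + I₂ b` are rewritten by `a = z/ψ` and `b = x + φ z/ψ`, and `M` comes from
  -- Cauchy–Schwarz.
  have key := unique_continuation hD hc (α := fun q ↦ -φ q) (β := fun q ↦ -ψ q)
    (x := fun q ↦ b q - φ q * a q) (z := fun q ↦ ψ q * a q)
    (M := fun q ↦ (R₂ q ^ 2 + ((R₁ q + R₂ q * φ q) / ψ q) ^ 2) +
      (I₂ q ^ 2 + ((I₁ q + I₂ q * φ q) / ψ q) ^ 2)) (p := p) (X := X) (Y := Y)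
    (hφ.neg.of_le (by exact_mod_cast le_top)) (hψ.neg.of_le (by exact_mod_cast le_top))
    ((hb.sub (hφ.mul ha)).of_le (by norm_cast)) ((hψ.mul ha).of_le (by norm_cast))
    (((cR₂.pow 2).add (((cR₁.add (cR₂.mul cφ)).div cψ hψ0).pow 2)).add
      ((cI₂.pow 2).add (((cI₁.add (cI₂.mul cφ)).div cψ hψ0).pow 2)))
    (fun q hq ↦ neg_ne_zero.mpr (hψ0 q hq)) ?_ hp hpY ?_
  · have a0 := (mul_eq_zero.mp key.2).resolve_left (hψ0 _ hpY)
    have := key.1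
    simp only [a0, mul_zero, sub_zero] at this
    exact ⟨a0, this⟩
  · intro q hq
    have da := ha.differentiableAt_of_isOpen hD hq
    have db := hb.differentiableAt_of_isOpen hD hq
    have dφ := hφ.differentiableAt_of_isOpen hD hq
    have dψ := hψ.differentiableAt_of_isOpen hD hq
    have ex : ∀ v, fderiv ℝ (fun q ↦ b q - φ q * a q) q v =
        fderiv ℝ b q v - φ q * fderiv ℝ a q v - fderiv ℝ φ q v * a q := by
      intro v
      rw [fderiv_fun_sub db (dφ.fun_mul da), fderiv_fun_mul dφ da]
      simp
      ring
    have ez : ∀ v, fderiv ℝ (fun q ↦ ψ q * a q) q v =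
        ψ q * fderiv ℝ a q v + fderiv ℝ ψ q v * a q := by
      intro v
      rw [fderiv_fun_mul dψ da]
      simp
      ring
    have ec : fderiv ℝ c q X = 2 * φ q * fderiv ℝ b q X + 2 * fderiv ℝ φ q X * b q -
        (φ q ^ 2 + ψ q ^ 2) * fderiv ℝ a q X -
        (2 * φ q * fderiv ℝ φ q X + 2 * ψ q * fderiv ℝ ψ q X) * a q := by
      have : c =ᶠ[𝓝 q] fun q ↦ 2 * φ q * b q - (φ q ^ 2 + ψ q ^ 2) * a q := by
        filter_upwards [hD.mem_nhds hq] with r hr using htr r hr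
      rw [this.fderiv_eq]
      have := ((dφ.hasFDerivAt.const_mul 2).mul db.hasFDerivAt).sub
        (((dφ.hasFDerivAt.pow 2).add (dψ.hasFDerivAt.pow 2)).mul da.hasFDerivAt)
      rw [show fderiv ℝ (fun q ↦ 2 * φ q * b q - (φ q ^ 2 + ψ q ^ 2) * a q) q = _ from this.fderiv]
      simp
      ring
    have g1 := h1 q hq
    have g2 := h2 q hq
    rw [ec] at g2
    have hψq := hψ0 q hq
    have eRe : (fderiv ℝ (fun q ↦ b q - φ q * a q) q Y +
          -φ q * fderiv ℝ (fun q ↦ b q - φ q * a q) q X - -ψ q * fderiv ℝ (fun q ↦ ψ q * a q) q X) =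
        R₂ q * (b q - φ q * a q) + (R₁ q + R₂ q * φ q) / ψ q * (ψ q * a q) := by
      rw [ex, ex, ez, div_mul_eq_mul_div, mul_comm (ψ q) (a q), ← mul_assoc,
        mul_div_assoc, div_self hψq]
      simp only [hR₁, hR₂]
      linear_combination g2 - φ q * g1
    have eIm : (fderiv ℝ (fun q ↦ ψ q * a q) q Y +
          -φ q * fderiv ℝ (fun q ↦ ψ q * a q) q X +
          -ψ q * fderiv ℝ (fun q ↦ b q - φ q * a q) q X) =
        I₂ q * (b q - φ q * a q) + (I₁ q + I₂ q * φ q) / ψ q * (ψ q * a q) := by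
      rw [ex, ez, ez, div_mul_eq_mul_div, mul_comm (ψ q) (a q), ← mul_assoc,
        mul_div_assoc, div_self hψq]
      simp only [hI₁, hI₂]
      linear_combination ψ q * g1
    rw [eRe, eIm, add_mul]
    exact add_le_add sq_add_mul_le sq_add_mul_le
  · filter_upwards [h0] with q hq
    simp [hq.1, hq.2]

variable {f n h m : E → Space}

/-- The determinant of the first fundamental form in the basis `(X, Y)`. -/
def gramDet (f : E → Space) (X Y : E) (p : E) : ℝ :=
  ⟪fderiv ℝ f p X, fderiv ℝ f p X⟫ * ⟪fderiv ℝ f p Y, fderiv ℝ f p Y⟫ -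
    ⟪fderiv ℝ f p X, fderiv ℝ f p Y⟫ ^ 2

theorem contDiffOn_firstForm (hD : IsOpen D) (hf : ContDiffOn ℝ ∞ f D) (v w : E) :
    ContDiffOn ℝ ∞ (fun p ↦ ⟪fderiv ℝ f p v, fderiv ℝ f p w⟫) D :=
  (contDiffOn_fderiv_apply hD hf v).inner ℝ (contDiffOn_fderiv_apply hD hf w)

/-- The pairing of a derivative of the normal with a second derivative of `f` is determined by the
two fundamental forms. -/
theorem inner_fderiv_normal_secondDeriv (hD : IsOpen D) (hf : IsNormalField D f n) {p X Y : E}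
    (hp : p ∈ D) (hΔ : gramDet f X Y p ≠ 0) (v w z : E) :
    ⟪fderiv ℝ n p v, secondDeriv f p w z⟫ =
      -((⟪fderiv ℝ f p Y, fderiv ℝ f p Y⟫ * ⟪secondDeriv f p w z, fderiv ℝ f p X⟫ -
          ⟪fderiv ℝ f p X, fderiv ℝ f p Y⟫ * ⟪secondDeriv f p w z, fderiv ℝ f p Y⟫) /
            gramDet f X Y p) * secondForm f n p v X -
        ((⟪fderiv ℝ f p X, fderiv ℝ f p X⟫ * ⟪secondDeriv f p w z, fderiv ℝ f p Y⟫ -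
          ⟪fderiv ℝ f p X, fderiv ℝ f p Y⟫ * ⟪secondDeriv f p w z, fderiv ℝ f p X⟫) /
            gramDet f X Y p) * secondForm f n p v Y := by
  have e := frame_expansion (hf.inner_fderiv p hp X) (hf.inner_fderiv p hp Y) (hf.inner_self p hp)
    hΔ (secondDeriv f p w z)
  conv_lhs => rw [e]
  rw [inner_add_right, inner_add_right, real_inner_smul_right, real_inner_smul_right,
    real_inner_smul_right, inner_fderiv_normal hD hf hp]
  simp only [secondForm, gramDet]
  ring

/-- A second fundamental form on a convex domain is determined by its restriction to
an open set, by the metric and by the mean curvature. -/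
theorem secondForm_eq_of_eventuallyEq (hD : IsOpen D) (hc : Convex ℝ D)
    (hf : IsNormalField D f n) (hh : IsNormalField D h m)
    (hg : ∀ p ∈ D, ∀ v w, ⟪fderiv ℝ f p v, fderiv ℝ f p w⟫ = ⟪fderiv ℝ h p v, fderiv ℝ h p w⟫)
    {p X Y : E} (hX : ∀ q ∈ D, 0 < ⟪fderiv ℝ f q X, fderiv ℝ f q X⟫)
    (hΔ : ∀ q ∈ D, 0 < gramDet f X Y q)
    (htr : ∀ q ∈ D, ⟪fderiv ℝ f q Y, fderiv ℝ f q Y⟫ * secondForm f n q X X -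
        2 * ⟪fderiv ℝ f q X, fderiv ℝ f q Y⟫ * secondForm f n q X Y +
        ⟪fderiv ℝ f q X, fderiv ℝ f q X⟫ * secondForm f n q Y Y =
      ⟪fderiv ℝ f q Y, fderiv ℝ f q Y⟫ * secondForm h m q X X -
        2 * ⟪fderiv ℝ f q X, fderiv ℝ f q Y⟫ * secondForm h m q X Y +
        ⟪fderiv ℝ f q X, fderiv ℝ f q X⟫ * secondForm h m q Y Y)
    (hp : p ∈ D) (hpY : p + Y ∈ D)
    (h0 : ∀ᶠ q in 𝓝 p, ∀ v w, secondForm f n q v w = secondForm h m q v w) :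
    secondForm f n (p + Y) X X = secondForm h m (p + Y) X X ∧
    secondForm f n (p + Y) X Y = secondForm h m (p + Y) X Y ∧
    secondForm f n (p + Y) Y Y = secondForm h m (p + Y) Y Y := by
  set eE : E → ℝ := fun q ↦ ⟪fderiv ℝ f q X, fderiv ℝ f q X⟫ with heE
  set eF : E → ℝ := fun q ↦ ⟪fderiv ℝ f q X, fderiv ℝ f q Y⟫ with heF
  set eG : E → ℝ := fun q ↦ ⟪fderiv ℝ f q Y, fderiv ℝ f q Y⟫ with heG
  have sE : ContDiffOn ℝ ∞ eE D := contDiffOn_firstForm hD hf.smooth X X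
  have sF : ContDiffOn ℝ ∞ eF D := contDiffOn_firstForm hD hf.smooth X Y
  have sG : ContDiffOn ℝ ∞ eG D := contDiffOn_firstForm hD hf.smooth Y Y
  have sΔ : ContDiffOn ℝ ∞ (gramDet f X Y) D := (sE.mul sG).sub (sF.pow 2)
  have hE0 : ∀ q ∈ D, eE q ≠ 0 := fun q hq ↦ (hX q hq).ne'
  have hΔ0 : ∀ q ∈ D, gramDet f X Y q ≠ 0 := fun q hq ↦ (hΔ q hq).ne'
  set a : E → ℝ := fun q ↦ secondForm f n q X X - secondForm h m q X X with ha
  set b : E → ℝ := fun q ↦ secondForm f n q X Y - secondForm h m q X Y with hb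
  set c : E → ℝ := fun q ↦ secondForm f n q Y Y - secondForm h m q Y Y with hcdef
  set φ : E → ℝ := fun q ↦ eF q / eE q with hφ
  set ψ : E → ℝ := fun q ↦ Real.sqrt (gramDet f X Y q) / eE q with hψ
  set k₁ : E → E → E → ℝ := fun w z q ↦ (eG q * ⟪secondDeriv f q w z, fderiv ℝ f q X⟫ -
    eF q * ⟪secondDeriv f q w z, fderiv ℝ f q Y⟫) / gramDet f X Y q with hk₁
  set k₂ : E → E → E → ℝ := fun w z q ↦ (eE q * ⟪secondDeriv f q w z, fderiv ℝ f q Y⟫ -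
    eF q * ⟪secondDeriv f q w z, fderiv ℝ f q X⟫) / gramDet f X Y q with hk₂
  have cin : ∀ w z v, ContinuousOn (fun q ↦ ⟪secondDeriv f q w z, fderiv ℝ f q v⟫) D :=
    fun w z v ↦ (contDiffOn_fderiv_apply hD (contDiffOn_fderiv_apply hD hf.smooth z)
      w).continuousOn.inner (contDiffOn_fderiv_apply hD hf.smooth v).continuousOn
  have ck₁ : ∀ w z, ContinuousOn (k₁ w z) D := fun w z ↦
    ((sG.continuousOn.mul (cin _ _ _)).sub (sF.continuousOn.mul (cin _ _ _))).div
      sΔ.continuousOn hΔ0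
  have ck₂ : ∀ w z, ContinuousOn (k₂ w z) D := fun w z ↦
    ((sE.continuousOn.mul (cin _ _ _)).sub (sF.continuousOn.mul (cin _ _ _))).div
      sΔ.continuousOn hΔ0
  have sφ : ContDiffOn ℝ ∞ φ D := sF.div sE hE0
  have sψ : ContDiffOn ℝ ∞ ψ D := (sΔ.sqrt hΔ0).div sE hE0
  have cφ := sφ.continuousOn
  have cψ := sψ.continuousOn
  have nf : ∀ q ∈ D, ∀ v w z, ⟪fderiv ℝ n q v, secondDeriv f q w z⟫ =
      -k₁ w z q * secondForm f n q v X - k₂ w z q * secondForm f n q v Y := fun q hq v w z ↦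
    inner_fderiv_normal_secondDeriv hD hf hq (hΔ0 q hq) v w z
  have nh : ∀ q ∈ D, ∀ v w z, ⟪fderiv ℝ m q v, secondDeriv h q w z⟫ =
      -k₁ w z q * secondForm h m q v X - k₂ w z q * secondForm h m q v Y := by
    intro q hq v w z
    have eΔ : gramDet h X Y q = gramDet f X Y q := by simp only [gramDet, hg q hq]
    rw [inner_fderiv_normal_secondDeriv hD hh hq (by rw [eΔ]; exact hΔ0 q hq) v w z, eΔ]
    simp only [← hg q hq, ← inner_secondDeriv_eq_of_isometric hD hf.smooth hh.smooth hg hq]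
    rfl
  -- The coefficients `k₁`, `k₂` are common to both maps because they depend only on the metric;
  -- subtracting the two Codazzi equations therefore gives a homogeneous linear equation for the
  -- difference of the forms.
  have dS : ∀ q ∈ D, ∀ v w z, fderiv ℝ (fun q ↦ secondForm f n q w z - secondForm h m q w z) q v -
      fderiv ℝ (fun q ↦ secondForm f n q v z - secondForm h m q v z) q w =
      -k₁ w z q * (secondForm f n q v X - secondForm h m q v X) -
        k₂ w z q * (secondForm f n q v Y - secondForm h m q v Y) +
      k₁ v z q * (secondForm f n q w X - secondForm h m q w X) +
        k₂ v z q * (secondForm f n q w Y - secondForm h m q w Y) := by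
    intro q hq v w z
    have df := fun v w ↦ (contDiffOn_secondForm hD hf v w).differentiableAt_of_isOpen hD hq
    have dh := fun v w ↦ (contDiffOn_secondForm hD hh v w).differentiableAt_of_isOpen hD hq
    have e1 := codazzi hD hf hq v w z
    have e2 := codazzi hD hh hq v w z
    rw [nf q hq, nf q hq] at e1
    rw [nh q hq, nh q hq] at e2
    rw [fderiv_fun_sub (df _ _) (dh _ _), fderiv_fun_sub (df _ _) (dh _ _), sub_apply, sub_apply]
    linear_combination e1 - e2
  have hb' : ∀ q ∈ D, secondForm f n q Y X - secondForm h m q Y X = b q := fun q hq ↦ by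
    rw [secondForm_comm hD hf hq, secondForm_comm hD hh hq]
  have htr' : ∀ q ∈ D, c q = 2 * φ q * b q - (φ q ^ 2 + ψ q ^ 2) * a q := by
    intro q hq
    have hE := hE0 q hq
    have e : φ q ^ 2 + ψ q ^ 2 = eG q / eE q := by
      simp only [hφ, hψ, div_pow, Real.sq_sqrt (hΔ q hq).le]
      rw [← add_div, div_eq_div_iff (pow_ne_zero 2 hE) hE]
      simp only [gramDet, heE, heF, heG]
      ring
    have := htr q hq
    rw [e]
    have h2 : eE q * c q = 2 * eF q * b q - eG q * a q := by
      simp only [ha, hb, hcdef, heE, heF, heG]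
      linear_combination this
    rw [hφ]
    field_simp
    linear_combination h2
  -- The coefficients `P₁, Q₁, P₂, Q₂` arise from `dS` for the directions `Y, X` by eliminating `c`
  -- through the trace condition `htr'`.
  have key := codazzi_unique_continuation hD hc (a := a) (b := b) (c := c) (φ := φ) (ψ := ψ)
    (X := X) (Y := Y) (p := p)
    (P₁ := fun q ↦ k₁ Y X q + k₂ X X q * (φ q ^ 2 + ψ q ^ 2))
    (Q₁ := fun q ↦ -k₁ X X q + k₂ Y X q - k₂ X X q * (2 * φ q))
    (P₂ := fun q ↦ k₁ Y Y q + k₂ X Y q * (φ q ^ 2 + ψ q ^ 2))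
    (Q₂ := fun q ↦ -k₁ X Y q + k₂ Y Y q - k₂ X Y q * (2 * φ q))
    ((contDiffOn_secondForm hD hf _ _).sub (contDiffOn_secondForm hD hh _ _))
    ((contDiffOn_secondForm hD hf _ _).sub (contDiffOn_secondForm hD hh _ _))
    sφ sψ (fun q hq ↦ div_ne_zero (Real.sqrt_ne_zero'.mpr (hΔ q hq)) (hE0 q hq)) htr'
    ((ck₁ _ _).add ((ck₂ _ _).mul ((cφ.pow 2).add (cψ.pow 2))))
    (((ck₁ _ _).neg.add (ck₂ _ _)).sub ((ck₂ _ _).mul (continuousOn_const.mul cφ)))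
    ((ck₁ _ _).add ((ck₂ _ _).mul ((cφ.pow 2).add (cψ.pow 2))))
    (((ck₁ _ _).neg.add (ck₂ _ _)).sub ((ck₂ _ _).mul (continuousOn_const.mul cφ)))
    ?_ ?_ hp hpY ?_
  · have := htr' _ hpY
    rw [key.1, key.2] at this
    exact ⟨sub_eq_zero.mp key.1, sub_eq_zero.mp key.2, sub_eq_zero.mp (by simpa using this)⟩
  · intro q hq
    have e := dS q hq Y X X
    have e' : fderiv ℝ (fun q ↦ secondForm f n q Y X - secondForm h m q Y X) q = fderiv ℝ b q :=
      Filter.EventuallyEq.fderiv_eq (by filter_upwards [hD.mem_nhds hq] with r hr using hb' r hr)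
    rw [e', hb' q hq] at e
    refine e.trans ?_
    have := htr' q hq
    change -k₁ X X q * b q - k₂ X X q * c q + k₁ Y X q * a q + k₂ Y X q * b q = _
    rw [this]
    ring
  · intro q hq
    have e := dS q hq Y X Y
    rw [hb' q hq] at e
    refine e.trans ?_
    have := htr' q hq
    change -k₁ X Y q * b q - k₂ X Y q * c q + k₁ Y Y q * a q + k₂ Y Y q * b q = _
    rw [this]
    ring
  · filter_upwards [h0] with q hq
    simp [ha, hb, hq]

end

/-! ### Rigidity of maps with equal fundamental forms -/

section

variable {E : Type*} [NormedAddCommGroup E] [NormedSpace ℝ E] {D : Set E} {f n h m : E → Space}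

/-- The difference of the Darboux frames of `f` and `h`, together with `f - h`. -/
def frameDiff (f n h m : E → Space) (X Y : E) (q : E) : Space × Space × Space × Space :=
  (f q - h q, fderiv ℝ f q X - fderiv ℝ h q X, fderiv ℝ f q Y - fderiv ℝ h q Y, n q - m q)

/-- Two frames with the same Gram matrix, and vectors with the same inner products against them: the
vectors have the same coefficients by `frame_expansion`, so their difference is that combination of
the differences of the frames. `C` is the sum of the absolute values of the coefficients. -/
theorem exists_norm_sub_le_frameDiff (hD : IsOpen D)
    (hf : IsNormalField D f n) (hh : IsNormalField D h m)
    (hg : ∀ p ∈ D, ∀ v w, ⟪fderiv ℝ f p v, fderiv ℝ f p w⟫ = ⟪fderiv ℝ h p v, fderiv ℝ h p w⟫)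
    {X Y : E} (hΔ : ∀ q ∈ D, 0 < gramDet f X Y q) {u v : E → Space} (hu : ContinuousOn u D)
    (hX : ∀ q ∈ D, ⟪u q, fderiv ℝ f q X⟫ = ⟪v q, fderiv ℝ h q X⟫)
    (hY : ∀ q ∈ D, ⟪u q, fderiv ℝ f q Y⟫ = ⟪v q, fderiv ℝ h q Y⟫)
    (hn : ∀ q ∈ D, ⟪u q, n q⟫ = ⟪v q, m q⟫) :
    ∃ C : E → ℝ, ContinuousOn C D ∧ ∀ q ∈ D, ‖u q - v q‖ ≤ C q * ‖frameDiff f n h m X Y q‖ := by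
  have sE := (contDiffOn_firstForm hD hf.smooth X X).continuousOn
  have sF := (contDiffOn_firstForm hD hf.smooth X Y).continuousOn
  have sG := (contDiffOn_firstForm hD hf.smooth Y Y).continuousOn
  have sΔ : ContinuousOn (gramDet f X Y) D := (sE.mul sG).sub (sF.pow 2)
  have hΔ0 : ∀ q ∈ D, gramDet f X Y q ≠ 0 := fun q hq ↦ (hΔ q hq).ne'
  have uX := hu.inner (𝕜 := ℝ) (contDiffOn_fderiv_apply hD hf.smooth X).continuousOn
  have uY := hu.inner (𝕜 := ℝ) (contDiffOn_fderiv_apply hD hf.smooth Y).continuousOn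
  have un := hu.inner (𝕜 := ℝ) hf.smooth_normal.continuousOn
  refine ⟨_, ((((sG.mul uX).sub (sF.mul uY)).div sΔ hΔ0).abs.add
    (((sE.mul uY).sub (sF.mul uX)).div sΔ hΔ0).abs).add un.abs, fun q hq ↦ ?_⟩
  have eΔ : gramDet h X Y q = gramDet f X Y q := by simp only [gramDet, hg q hq]
  have e1 := frame_expansion (hf.inner_fderiv q hq X) (hf.inner_fderiv q hq Y)
    (hf.inner_self q hq) (hΔ0 q hq) (u q)
  have e2 := frame_expansion (hh.inner_fderiv q hq X) (hh.inner_fderiv q hq Y)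
    (hh.inner_self q hq) (by rw [← gramDet, eΔ]; exact hΔ0 q hq) (v q)
  rw [← gramDet] at e1 e2
  rw [eΔ] at e2
  simp only [← hg q hq, ← hX q hq, ← hY q hq, ← hn q hq] at e2
  have n1 : ‖fderiv ℝ f q X - fderiv ℝ h q X‖ ≤ ‖frameDiff f n h m X Y q‖ :=
    (norm_fst_le _).trans (norm_snd_le (frameDiff f n h m X Y q))
  have n2 : ‖fderiv ℝ f q Y - fderiv ℝ h q Y‖ ≤ ‖frameDiff f n h m X Y q‖ :=
    ((norm_fst_le _).trans (norm_snd_le _)).trans (norm_snd_le (frameDiff f n h m X Y q))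
  have n3 : ‖n q - m q‖ ≤ ‖frameDiff f n h m X Y q‖ :=
    ((norm_snd_le _).trans (norm_snd_le _)).trans (norm_snd_le (frameDiff f n h m X Y q))
  have bound : ∀ (c₁ c₂ c₃ : ℝ), u q = c₁ • fderiv ℝ f q X + c₂ • fderiv ℝ f q Y + c₃ • n q →
      v q = c₁ • fderiv ℝ h q X + c₂ • fderiv ℝ h q Y + c₃ • m q →
      ‖u q - v q‖ ≤ (|c₁| + |c₂| + |c₃|) * ‖frameDiff f n h m X Y q‖ := by
    intro c₁ c₂ c₃ h1 h2
    have : u q - v q = c₁ • (fderiv ℝ f q X - fderiv ℝ h q X) +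
        c₂ • (fderiv ℝ f q Y - fderiv ℝ h q Y) + c₃ • (n q - m q) := by
      rw [h1, h2]
      module
    rw [this]
    refine (norm_add₃_le).trans ?_
    rw [norm_smul, norm_smul, norm_smul, add_mul, add_mul]
    simp only [Real.norm_eq_abs]
    gcongr
  exact bound _ _ _ e1 e2

/-- Two maps with the same fundamental forms that agree to first order at a point agree. -/
theorem eq_of_fundamental_forms_eq (hD : IsOpen D) (hc : Convex ℝ D)
    (hf : IsNormalField D f n) (hh : IsNormalField D h m)
    (hg : ∀ p ∈ D, ∀ v w, ⟪fderiv ℝ f p v, fderiv ℝ f p w⟫ = ⟪fderiv ℝ h p v, fderiv ℝ h p w⟫)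
    {X Y : E} (hΔ : ∀ q ∈ D, 0 < gramDet f X Y q)
    (hB : ∀ q ∈ D, ∀ v w, secondForm f n q v w = secondForm h m q v w)
    {p : E} (hp : p ∈ D) (hpY : p + Y ∈ D) (h0 : f p = h p) (h1 : fderiv ℝ f p = fderiv ℝ h p)
    (h2 : n p = m p) : f (p + Y) = h (p + Y) := by
  have hγ : ∀ t ∈ Icc (0 : ℝ) 1, p + t • Y ∈ D := fun t ht ↦ hc.add_smul_mem hp hpY ht
  have cf := fun v ↦ (contDiffOn_fderiv_apply hD hf.smooth v)
  have ch := fun v ↦ (contDiffOn_fderiv_apply hD hh.smooth v)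
  have hfh : ∀ v w, ∀ q ∈ D, ∀ z, ⟪secondDeriv f q v w, fderiv ℝ f q z⟫ =
      ⟪secondDeriv h q v w, fderiv ℝ h q z⟫ := fun v w q hq z ↦
    inner_secondDeriv_eq_of_isometric hD hf.smooth hh.smooth hg hq v w z
  have hfn : ∀ v w, ∀ q ∈ D, ⟪secondDeriv f q v w, n q⟫ = ⟪secondDeriv h q v w, m q⟫ :=
    fun v w q hq ↦ by
      rw [inner_normal_secondDeriv hD hf hq, inner_normal_secondDeriv hD hh hq, hB q hq]
  have csd : ∀ v w, ContinuousOn (fun q ↦ secondDeriv f q v w) D := fun v w ↦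
    (contDiffOn_fderiv_apply hD (cf w) v).continuousOn
  obtain ⟨C₁, cC₁, hC₁⟩ := exists_norm_sub_le_frameDiff hD hf hh hg hΔ (csd Y X)
    (v := fun q ↦ secondDeriv h q Y X) (fun q hq ↦ hfh Y X q hq X) (fun q hq ↦ hfh Y X q hq Y)
    (fun q hq ↦ hfn Y X q hq)
  obtain ⟨C₂, cC₂, hC₂⟩ := exists_norm_sub_le_frameDiff hD hf hh hg hΔ (csd Y Y)
    (v := fun q ↦ secondDeriv h q Y Y) (fun q hq ↦ hfh Y Y q hq X) (fun q hq ↦ hfh Y Y q hq Y)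
    (fun q hq ↦ hfn Y Y q hq)
  obtain ⟨C₃, cC₃, hC₃⟩ := exists_norm_sub_le_frameDiff hD hf hh hg hΔ
    (contDiffOn_fderiv_apply hD hf.smooth_normal Y).continuousOn
    (v := fun q ↦ fderiv ℝ m q Y) (fun q hq ↦ neg_injective (hB q hq Y X))
    (fun q hq ↦ neg_injective (hB q hq Y Y))
    (fun q hq ↦ by rw [inner_fderiv_normal hD hf hq, inner_fderiv_normal hD hh hq])
  have cγ : Continuous fun t : ℝ ↦ p + t • Y := by fun_prop
  obtain ⟨K₁, hK₁⟩ := isCompact_Icc.exists_bound_of_continuousOn (cC₁.comp cγ.continuousOn hγ)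
  obtain ⟨K₂, hK₂⟩ := isCompact_Icc.exists_bound_of_continuousOn (cC₂.comp cγ.continuousOn hγ)
  obtain ⟨K₃, hK₃⟩ := isCompact_Icc.exists_bound_of_continuousOn (cC₃.comp cγ.continuousOn hγ)
  set K := max 1 (max K₁ (max K₂ K₃)) with hK
  have hline : ∀ t : ℝ, HasDerivAt (fun t : ℝ ↦ p + t • Y) Y t := fun t ↦ by
    simpa using ((hasDerivAt_id t).smul_const Y).const_add p
  have hder : ∀ {u : E → Space}, ContDiffOn ℝ ∞ u D → ∀ t ∈ Icc (0 : ℝ) 1,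
      HasDerivAt (fun t : ℝ ↦ u (p + t • Y)) (fderiv ℝ u (p + t • Y) Y) t := fun hu t ht ↦
    (hu.differentiableAt_of_isOpen hD (hγ t ht)).hasFDerivAt.comp_hasDerivAt t (hline t)
  set W : ℝ → Space × Space × Space × Space := fun t ↦ frameDiff f n h m X Y (p + t • Y) with hW
  set W' : ℝ → Space × Space × Space × Space := fun t ↦
    (fderiv ℝ f (p + t • Y) Y - fderiv ℝ h (p + t • Y) Y,
      secondDeriv f (p + t • Y) Y X - secondDeriv h (p + t • Y) Y X,
      secondDeriv f (p + t • Y) Y Y - secondDeriv h (p + t • Y) Y Y,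
      fderiv ℝ n (p + t • Y) Y - fderiv ℝ m (p + t • Y) Y) with hW'
  have hWd : ∀ t ∈ Icc (0 : ℝ) 1, HasDerivAt W (W' t) t := fun t ht ↦
    ((hder hf.smooth t ht).sub (hder hh.smooth t ht)).prodMk
      (((hder (cf X) t ht).sub (hder (ch X) t ht)).prodMk
        (((hder (cf Y) t ht).sub (hder (ch Y) t ht)).prodMk
          ((hder hf.smooth_normal t ht).sub (hder hh.smooth_normal t ht))))
  -- Every derivative of the frame has inner products with the frame prescribed by the fundamental
  -- forms, so `W` satisfies a linear differential inequality along the segment; `W 0 = 0` and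
  -- Gronwall's inequality give `W 1 = 0`.
  have hb : ∀ t ∈ Icc (0 : ℝ) 1, ‖W' t‖ ≤ K * ‖W t‖ := by
    intro t ht
    have hq := hγ t ht
    have aux : ∀ c : ℝ, c ≤ K → c * ‖W t‖ ≤ K * ‖W t‖ := fun c hc ↦
      mul_le_mul_of_nonneg_right hc (norm_nonneg _)
    refine norm_prod_le_iff.mpr ⟨?_, norm_prod_le_iff.mpr ⟨?_, norm_prod_le_iff.mpr ⟨?_, ?_⟩⟩⟩
    · refine le_trans ?_ (aux 1 (le_max_left _ _))
      rw [one_mul]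
      exact ((norm_fst_le _).trans (norm_snd_le _)).trans (norm_snd_le (W t))
    · exact (hC₁ _ hq).trans (aux _ (((le_abs_self _).trans (hK₁ t ht)).trans (by simp [hK])))
    · exact (hC₂ _ hq).trans (aux _ (((le_abs_self _).trans (hK₂ t ht)).trans (by simp [hK])))
    · exact (hC₃ _ hq).trans (aux _ (((le_abs_self _).trans (hK₃ t ht)).trans (by simp [hK])))
  have hW0 : W 0 = 0 := by simp [hW, frameDiff, h0, h1, h2]
  have := norm_le_gronwallBound_of_norm_deriv_right_le (f := W) (f' := W') (δ := 0) (K := K)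
    (ε := 0) (a := 0) (b := 1) (fun t ht ↦ (hWd t ht).continuousAt.continuousWithinAt)
    (fun t ht ↦ (hWd t (Ico_subset_Icc_self ht)).hasDerivWithinAt) (by simp [hW0])
    (fun t ht ↦ by simpa using hb t (Ico_subset_Icc_self ht)) 1 (by simp)
  rw [gronwallBound_ε0_δ0] at this
  have h3 : W 1 = 0 := norm_le_zero_iff.mp this
  have h4 := congrArg Prod.fst h3
  simp only [hW, frameDiff, one_smul, Prod.fst_zero] at h4
  exact sub_eq_zero.mp h4

end

/-! ### Principal curvatures determine the mean curvature -/

/-- The eigenvalue equation of a `2 × 2` pencil of symmetric matrices. -/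
theorem exists_eigenvector_iff {e f g l m n k : ℝ} :
    (∃ a b : ℝ, (a ≠ 0 ∨ b ≠ 0) ∧ a * l + b * m = k * (a * e + b * f) ∧
      a * m + b * n = k * (a * f + b * g)) ↔
    (e * g - f ^ 2) * k ^ 2 - (e * n + g * l - 2 * f * m) * k + (l * n - m ^ 2) = 0 := by
  constructor
  · rintro ⟨a, b, hab, h1, h2⟩
    rcases hab with ha | hb
    · refine (mul_eq_zero.mp ?_).resolve_left ha
      linear_combination (n - k * g) * h1 - (m - k * f) * h2
    · refine (mul_eq_zero.mp ?_).resolve_left hb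
      linear_combination (l - k * e) * h2 - (m - k * f) * h1
  · intro h
    -- The kernel vector is read off from the first row of the singular matrix, or is the first
    -- basis vector when that row vanishes.
    by_cases h0 : m - k * f = 0 ∧ l - k * e = 0
    · exact ⟨1, 0, by simp, by linear_combination h0.2, by linear_combination h0.1⟩
    · refine ⟨-(m - k * f), l - k * e, ?_, by ring, by linear_combination h⟩
      rw [neg_ne_zero]
      tauto

theorem quadratic_eq_zero_iff_of_pos {d t q k : ℝ} (hd : 0 < d) (hdisc : 0 ≤ t ^ 2 - 4 * d * q) :
    d * k ^ 2 - t * k + q = 0 ↔ 2 * d * k = t + √(t ^ 2 - 4 * d * q) ∨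
      2 * d * k = t - √(t ^ 2 - 4 * d * q) := by
  have hs := Real.sq_sqrt hdisc
  set s := √(t ^ 2 - 4 * d * q)
  have e : 4 * d * (d * k ^ 2 - t * k + q) = (2 * d * k - (t + s)) * (2 * d * k - (t - s)) := by
    linear_combination hs
  rw [← sub_eq_zero (b := t + s), ← sub_eq_zero (b := t - s), ← mul_eq_zero, ← e]
  simp [hd.ne']

/-- Quadratic polynomials with real roots, the same leading coefficient and the same set of roots
have the same linear coefficient. -/
theorem linear_coeff_eq_of_roots_eq {d t q t' q' : ℝ} (hd : 0 < d) (h1 : 0 ≤ t ^ 2 - 4 * d * q)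
    (h2 : 0 ≤ t' ^ 2 - 4 * d * q')
    (h : ∀ k, d * k ^ 2 - t * k + q = 0 ↔ d * k ^ 2 - t' * k + q' = 0) : t = t' := by
  simp only [quadratic_eq_zero_iff_of_pos hd h1, quadratic_eq_zero_iff_of_pos hd h2] at h
  have s0 := Real.sqrt_nonneg (t ^ 2 - 4 * d * q)
  have s0' := Real.sqrt_nonneg (t' ^ 2 - 4 * d * q')
  set s := √(t ^ 2 - 4 * d * q)
  set s' := √(t' ^ 2 - 4 * d * q')
  have c : ∀ r, 2 * d * (r / (2 * d)) = r := fun r ↦ by field_simp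
  have a1 := (h ((t + s) / (2 * d))).mp (by simp [c])
  have a2 := (h ((t - s) / (2 * d))).mp (by simp [c])
  have a3 := (h ((t' + s') / (2 * d))).mpr (by simp [c])
  have a4 := (h ((t' - s') / (2 * d))).mpr (by simp [c])
  simp only [c] at a1 a2 a3 a4
  -- The roots are `(t ± s) / 2d` and `(t' ± s') / 2d` with `s, s' ≥ 0`. Every way of matching the
  -- two sets, double roots included, forces equal sums.
  rcases a1 with a1 | a1 <;> rcases a2 with a2 | a2 <;> rcases a3 with a3 | a3 <;>
    rcases a4 with a4 | a4 <;> linarith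

/-- The shape operator is self-adjoint, so its eigenvalues are real: after multiplication by `e²`
the discriminant is a square plus a nonnegative multiple of a square. -/
theorem discriminant_nonneg {e f g l m n : ℝ} (he : 0 < e) (hd : 0 < e * g - f ^ 2) :
    0 ≤ (e * n + g * l - 2 * f * m) ^ 2 - 4 * (e * g - f ^ 2) * (l * n - m ^ 2) := by
  have : e ^ 2 * ((e * n + g * l - 2 * f * m) ^ 2 - 4 * (e * g - f ^ 2) * (l * n - m ^ 2)) =
      (e * (e * n + g * l - 2 * f * m) - 2 * l * (e * g - f ^ 2)) ^ 2 +
        4 * (e * g - f ^ 2) * (e * m - f * l) ^ 2 := by ring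
  refine nonneg_of_mul_nonneg_right (this ▸ ?_) (pow_pos he 2)
  positivity

/-- The vector `Y` turned by a right angle. -/
def turn (Y : Plane) : Plane := !₂[-Y 1, Y 0]

theorem exists_combination {Y : Plane} (hY : Y ≠ 0) (v : Plane) :
    ∃ a b : ℝ, v = a • turn Y + b • Y := by
  have hN : Y 0 ^ 2 + Y 1 ^ 2 ≠ 0 := by
    intro h
    refine hY ?_
    ext i
    fin_cases i <;> simp <;> nlinarith [sq_nonneg (Y 0), sq_nonneg (Y 1)]
  refine ⟨(v 1 * Y 0 - v 0 * Y 1) / (Y 0 ^ 2 + Y 1 ^ 2),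
    (v 0 * Y 0 + v 1 * Y 1) / (Y 0 ^ 2 + Y 1 ^ 2), ?_⟩
  ext i
  fin_cases i
  · simp [turn]
    field_simp
    ring
  · simp [turn]
    field_simp
    ring

theorem combination_eq_zero {Y : Plane} (hY : Y ≠ 0) {a b : ℝ} (h : a • turn Y + b • Y = 0) :
    a = 0 ∧ b = 0 := by
  have hN : Y 0 ^ 2 + Y 1 ^ 2 ≠ 0 := by
    intro h
    refine hY ?_
    ext i
    fin_cases i <;> simp <;> nlinarith [sq_nonneg (Y 0), sq_nonneg (Y 1)]
  have h0 := congrArg (fun v : Plane ↦ v 0) h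
  have h1 := congrArg (fun v : Plane ↦ v 1) h
  simp [turn] at h0 h1
  constructor
  · refine (mul_eq_zero.mp ?_).resolve_right hN
    linear_combination Y 0 * h1 - Y 1 * h0
  · refine (mul_eq_zero.mp ?_).resolve_right hN
    linear_combination Y 0 * h0 + Y 1 * h1

/-! ### The local uniqueness theorem -/

section

variable {f n h m : Plane → Space} {D : Set Plane}

theorem secondForm_combination (f n : Plane → Space) (p X Y : Plane) (a b c d : ℝ) :
    secondForm f n p (a • X + b • Y) (c • X + d • Y) =
      a * c * secondForm f n p X X + a * d * secondForm f n p X Y +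
        b * c * secondForm f n p Y X + b * d * secondForm f n p Y Y := by
  simp only [secondForm, map_add, map_smul, inner_add_left, inner_add_right, real_inner_smul_left,
    real_inner_smul_right]
  ring

/-- One step of Gram–Schmidt: `df (-r X + e Y)` is nonzero and its squared length is `e` times the
Gram determinant. -/
theorem gramDet_pos {p Y : Plane} (himm : ∀ v : Plane, v ≠ 0 → fderiv ℝ f p v ≠ 0) (hY : Y ≠ 0) :
    0 < ⟪fderiv ℝ f p (turn Y), fderiv ℝ f p (turn Y)⟫ ∧ 0 < gramDet f (turn Y) Y p := by
  have hX : turn Y ≠ 0 := fun h ↦ one_ne_zero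
    (combination_eq_zero hY (a := 1) (b := 0) (by simp [h])).1
  have hE : 0 < ⟪fderiv ℝ f p (turn Y), fderiv ℝ f p (turn Y)⟫ :=
    real_inner_self_pos.mpr (himm _ hX)
  refine ⟨hE, ?_⟩
  set X := turn Y with hXdef
  set e := ⟪fderiv ℝ f p X, fderiv ℝ f p X⟫ with he
  set r := ⟪fderiv ℝ f p X, fderiv ℝ f p Y⟫ with hr
  have hu : (-r) • X + e • Y ≠ 0 := fun h ↦ hE.ne' (combination_eq_zero hY h).2
  have h1 := real_inner_self_pos.mpr (himm _ hu)
  have h2 : ⟪fderiv ℝ f p ((-r) • X + e • Y), fderiv ℝ f p ((-r) • X + e • Y)⟫ =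
      e * gramDet f X Y p := by
    simp only [map_add, map_smul, inner_add_left, inner_add_right, real_inner_smul_left,
      real_inner_smul_right, gramDet, real_inner_comm (fderiv ℝ f p X) (fderiv ℝ f p Y), ← he, ← hr]
    ring
  rw [h2] at h1
  exact pos_of_mul_pos_right h1 hE.le

/-- The principal curvatures of a map of the plane, with respect to a normal field. -/
def planePrincipalCurvatures (f n : Plane → Space) (p : Plane) : Set ℝ :=
  {k | ∃ v : Plane, v ≠ 0 ∧
    ∀ w : Plane, secondForm f n p v w = k * ⟪fderiv ℝ f p v, fderiv ℝ f p w⟫}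

/-- The eigenvector equation need only be tested on the basis `(turn Y, Y)`, where it is a `2 × 2`
pencil. The linear coefficient of its characteristic polynomial is the metric trace of the second
form times the Gram determinant. -/
theorem mem_planePrincipalCurvatures_iff (hD : IsOpen D) (hf : IsNormalField D f n) {p Y : Plane}
    (hp : p ∈ D) (hY : Y ≠ 0) (k : ℝ) :
    k ∈ planePrincipalCurvatures f n p ↔
      gramDet f (turn Y) Y p * k ^ 2 -
        (⟪fderiv ℝ f p (turn Y), fderiv ℝ f p (turn Y)⟫ * secondForm f n p Y Y +
          ⟪fderiv ℝ f p Y, fderiv ℝ f p Y⟫ * secondForm f n p (turn Y) (turn Y) -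
          2 * ⟪fderiv ℝ f p (turn Y), fderiv ℝ f p Y⟫ * secondForm f n p (turn Y) Y) * k +
        (secondForm f n p (turn Y) (turn Y) * secondForm f n p Y Y -
          secondForm f n p (turn Y) Y ^ 2) = 0 := by
  set X := turn Y with hX
  rw [gramDet, ← exists_eigenvector_iff]
  have hcomm := secondForm_comm hD hf hp Y X
  have gcomm : ⟪fderiv ℝ f p Y, fderiv ℝ f p X⟫ = ⟪fderiv ℝ f p X, fderiv ℝ f p Y⟫ :=
    real_inner_comm _ _
  constructor
  · rintro ⟨v, hv, hvw⟩
    obtain ⟨a, b, rfl⟩ := exists_combination hY v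
    refine ⟨a, b, ?_, ?_, ?_⟩
    · by_contra hab
      push Not at hab
      exact hv (by simp [hab.1, hab.2])
    · have e := hvw X
      have := secondForm_combination f n p X Y a b 1 0
      simp only [one_smul, zero_smul, add_zero, mul_one, mul_zero] at this
      rw [← hX, this, hcomm] at e
      simp only [map_add, map_smul, inner_add_left, real_inner_smul_left, gcomm] at e
      linear_combination e
    · have e := hvw Y
      have := secondForm_combination f n p X Y a b 0 1
      simp only [one_smul, zero_smul, zero_add, mul_one, mul_zero] at this
      rw [← hX, this] at e
      simp only [map_add, map_smul, inner_add_left, real_inner_smul_left] at e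
      linear_combination e
  · rintro ⟨a, b, hab, h1, h2⟩
    refine ⟨a • X + b • Y, fun h0 ↦ ?_, fun w ↦ ?_⟩
    · have := combination_eq_zero hY h0
      tauto
    · obtain ⟨c, d, rfl⟩ := exists_combination hY w
      rw [← hX, secondForm_combination, hcomm]
      simp only [map_add, map_smul, inner_add_left, inner_add_right, real_inner_smul_left,
        real_inner_smul_right, gcomm]
      linear_combination c * h1 + d * h2

/-- The local form of the uniqueness theorem: isometric maps of a convex domain of the plane with
the same principal curvatures agree if they agree near a point. -/
theorem eqOn_of_planePrincipalCurvatures_eq (hD : IsOpen D) (hc : Convex ℝ D)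
    (hf : IsNormalField D f n) (hh : IsNormalField D h m)
    (himm : ∀ p ∈ D, ∀ v : Plane, v ≠ 0 → fderiv ℝ f p v ≠ 0)
    (hg : ∀ p ∈ D, ∀ v w, ⟪fderiv ℝ f p v, fderiv ℝ f p w⟫ = ⟪fderiv ℝ h p v, fderiv ℝ h p w⟫)
    (hk : ∀ p ∈ D, planePrincipalCurvatures f n p = planePrincipalCurvatures h m p)
    {p : Plane} (hp : p ∈ D) (hfh : f =ᶠ[𝓝 p] h) (hnm : n =ᶠ[𝓝 p] m) : EqOn f h D := by
  have h0 : ∀ᶠ q in 𝓝 p, ∀ v w, secondForm f n q v w = secondForm h m q v w := by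
    filter_upwards [eventually_eventually_nhds.mpr hfh, eventually_eventually_nhds.mpr hnm]
      with q h1 h2 v w
    have e1 : fderiv ℝ f q = fderiv ℝ h q := Filter.EventuallyEq.fderiv_eq h1
    have e2 : fderiv ℝ n q = fderiv ℝ m q := Filter.EventuallyEq.fderiv_eq h2
    rw [secondForm, secondForm, e1, e2]
  have htr : ∀ Y : Plane, Y ≠ 0 → ∀ q ∈ D,
      ⟪fderiv ℝ f q Y, fderiv ℝ f q Y⟫ * secondForm f n q (turn Y) (turn Y) -
        2 * ⟪fderiv ℝ f q (turn Y), fderiv ℝ f q Y⟫ * secondForm f n q (turn Y) Y +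
        ⟪fderiv ℝ f q (turn Y), fderiv ℝ f q (turn Y)⟫ * secondForm f n q Y Y =
      ⟪fderiv ℝ f q Y, fderiv ℝ f q Y⟫ * secondForm h m q (turn Y) (turn Y) -
        2 * ⟪fderiv ℝ f q (turn Y), fderiv ℝ f q Y⟫ * secondForm h m q (turn Y) Y +
        ⟪fderiv ℝ f q (turn Y), fderiv ℝ f q (turn Y)⟫ * secondForm h m q Y Y := by
    intro Y hY q hq
    obtain ⟨hE, hΔ⟩ := gramDet_pos (himm q hq) hY
    have eΔ : gramDet h (turn Y) Y q = gramDet f (turn Y) Y q := by simp only [gramDet, hg q hq]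
    have hroots : ∀ k, _ ↔ _ := fun k ↦ (mem_planePrincipalCurvatures_iff hD hf hq hY k).symm.trans
      (((Set.ext_iff.mp (hk q hq)) k).trans (mem_planePrincipalCurvatures_iff hD hh hq hY k))
    simp only [eΔ, ← hg q hq] at hroots
    have := linear_coeff_eq_of_roots_eq hΔ (discriminant_nonneg hE hΔ)
      (discriminant_nonneg hE hΔ) hroots
    linear_combination this
  have hB : ∀ q ∈ D, ∀ v w, secondForm f n q v w = secondForm h m q v w := by
    intro q hq v w
    by_cases hqp : q = p
    · rw [hqp]
      exact h0.self_of_nhds v w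
    · have hY : q - p ≠ 0 := sub_ne_zero.mpr hqp
      set Y := q - p
      have hpY : p + Y = q := add_sub_cancel p q
      -- Unique continuation runs along the segment from `p` to `q`, so the basis `(turn Y, Y)` is
      -- adapted to `q`.
      obtain ⟨e1, e2, e3⟩ := secondForm_eq_of_eventuallyEq hD hc hf hh hg (p := p)
        (X := turn Y) (Y := Y) (fun r hr ↦ (gramDet_pos (himm r hr) hY).1)
        (fun r hr ↦ (gramDet_pos (himm r hr) hY).2) (htr Y hY) hp (by rwa [hpY]) h0
      rw [hpY] at e1 e2 e3
      obtain ⟨a, b, rfl⟩ := exists_combination hY v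
      obtain ⟨c, d, rfl⟩ := exists_combination hY w
      rw [secondForm_combination, secondForm_combination, secondForm_comm hD hf hq Y (turn Y),
        secondForm_comm hD hh hq Y (turn Y), e1, e2, e3]
  intro q hq
  by_cases hqp : q = p
  · rw [hqp]
    exact hfh.self_of_nhds
  · have hY : q - p ≠ 0 := sub_ne_zero.mpr hqp
    have hpY : p + (q - p) = q := add_sub_cancel p q
    have := eq_of_fundamental_forms_eq hD hc hf hh hg (X := turn (q - p)) (Y := q - p)
      (fun r hr ↦ (gramDet_pos (himm r hr) hY).2) hB hp (by rwa [hpY]) hfh.self_of_nhds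
      hfh.fderiv_eq hnm.self_of_nhds
    rwa [hpY] at this

end

/-! ### Cross products and unit normals -/

theorem inner_eq_dotProduct (a b : Space) : ⟪a, b⟫ = dotProduct a.ofLp b.ofLp := by
  simp [PiLp.inner_apply, dotProduct, mul_comm]

theorem inner_cross_left (a b : Space) : ⟪cross a b, a⟫ = 0 := by
  rw [inner_eq_dotProduct, dotProduct_comm]
  exact dot_self_cross _ _

theorem inner_cross_right (a b : Space) : ⟪cross a b, b⟫ = 0 := by
  rw [inner_eq_dotProduct, dotProduct_comm]
  exact dot_cross_self _ _

theorem inner_cross_self (a b : Space) :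
    ⟪cross a b, cross a b⟫ = ⟪a, a⟫ * ⟪b, b⟫ - ⟪a, b⟫ ^ 2 := by
  simp only [inner_eq_dotProduct]
  refine (cross_dot_cross _ _ _ _).trans ?_
  rw [dotProduct_comm b.ofLp a.ofLp, sq]

theorem cross_combination (a b : Space) (p q r s : ℝ) :
    cross (p • a + q • b) (r • a + s • b) = (p * s - r * q) • cross a b := by
  ext i
  fin_cases i <;> simp [cross, cross_apply] <;> ring

theorem _root_.ContDiffOn.cross {E : Type*} [NormedAddCommGroup E] [NormedSpace ℝ E]
    {a b : E → Space} {D : Set E} {k : WithTop ℕ∞} (ha : ContDiffOn ℝ k a D)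
    (hb : ContDiffOn ℝ k b D) : ContDiffOn ℝ k (fun p ↦ cross (a p) (b p)) D := by
  rw [contDiffOn_euclidean] at ha hb ⊢
  have h : ∀ i j, ContDiffOn ℝ k (fun p ↦ a p i * b p j) D := fun i j ↦ (ha i).mul (hb j)
  intro i
  fin_cases i
  · exact ((h 1 2).sub (h 2 1)).congr fun p _ ↦ by simp [SurfaceCongruence.cross, cross_apply]
  · exact ((h 2 0).sub (h 0 2)).congr fun p _ ↦ by simp [SurfaceCongruence.cross, cross_apply]
  · exact ((h 0 1).sub (h 1 0)).congr fun p _ ↦ by simp [SurfaceCongruence.cross, cross_apply]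

/-- As a determinant, the triple product is multiplied by `det R` when a linear map `R` is applied
to its three arguments. -/
theorem inner_cross_eq_det (a b c : Space) :
    ⟪cross a b, c⟫ = (EuclideanSpace.basisFun (Fin 3) ℝ).toBasis.det ![c, a, b] := by
  rw [inner_eq_dotProduct, dotProduct_comm]
  refine (triple_product_eq_det _ _ _).trans ?_
  rw [Module.Basis.det_apply, ← Matrix.det_transpose]
  congr 1
  ext i j
  fin_cases i <;> fin_cases j <;> simp [Module.Basis.toMatrix_apply]

/-- Rotations commute with the cross product. -/
theorem cross_map_of_det_eq_one (R : Space ≃ₗᵢ[ℝ] Space)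
    (hR : LinearMap.det (R.toLinearEquiv : Space →ₗ[ℝ] Space) = 1) (a b : Space) :
    cross (R a) (R b) = R (cross a b) := by
  refine ext_inner_right ℝ fun c ↦ ?_
  obtain ⟨c, rfl⟩ := R.surjective c
  rw [R.inner_map_map, inner_cross_eq_det, inner_cross_eq_det]
  have := (EuclideanSpace.basisFun (Fin 3) ℝ).toBasis.det_comp
    (R.toLinearEquiv : Space →ₗ[ℝ] Space) ![c, a, b]
  rw [hR, one_mul] at this
  rw [← this]
  congr 1
  ext i
  fin_cases i <;> rfl

/-- The unit vector in the direction of the cross product. -/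
def unitCross (a b : Space) : Space := ‖cross a b‖⁻¹ • cross a b

/-- The unit normal field of an immersion of a domain of the plane. -/
def planeNormal (f : Plane → Space) (p : Plane) : Space :=
  unitCross (fderiv ℝ f p (EuclideanSpace.single 0 1)) (fderiv ℝ f p (EuclideanSpace.single 1 1))

theorem turn_single : turn (EuclideanSpace.single 0 1) = EuclideanSpace.single 1 1 := by
  ext i
  fin_cases i <;> simp [turn]

theorem single_ne_zero : (EuclideanSpace.single 0 1 : Plane) ≠ 0 := fun h ↦ by
  have := congrArg (fun v : Plane ↦ v 0) h
  simp at this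

theorem eq_combination_single (v : Plane) :
    v = v 0 • EuclideanSpace.single 0 1 + v 1 • EuclideanSpace.single 1 1 := by
  ext i
  fin_cases i <;> simp

section

variable {f n h m : Plane → Space} {D : Set Plane}

theorem cross_fderiv_ne_zero {p : Plane} (himm : ∀ v : Plane, v ≠ 0 → fderiv ℝ f p v ≠ 0) :
    cross (fderiv ℝ f p (EuclideanSpace.single 0 1)) (fderiv ℝ f p (EuclideanSpace.single 1 1))
      ≠ 0 := by
  have h1 := (gramDet_pos himm single_ne_zero).2
  rw [gramDet, turn_single] at h1
  intro h0
  have h2 := inner_cross_self (fderiv ℝ f p (EuclideanSpace.single 0 1))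
    (fderiv ℝ f p (EuclideanSpace.single 1 1))
  rw [h0, inner_zero_left, real_inner_comm (fderiv ℝ f p (EuclideanSpace.single 1 1))
    (fderiv ℝ f p (EuclideanSpace.single 0 1))] at h2
  linarith

theorem isNormalField_planeNormal (hD : IsOpen D) (hf : ContDiffOn ℝ ∞ f D)
    (himm : ∀ p ∈ D, ∀ v : Plane, v ≠ 0 → fderiv ℝ f p v ≠ 0) :
    IsNormalField D f (planeNormal f) where
  smooth := hf
  smooth_normal := by
    have hc := (contDiffOn_fderiv_apply hD hf (EuclideanSpace.single 0 1)).cross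
      (contDiffOn_fderiv_apply hD hf (EuclideanSpace.single 1 1))
    exact ((hc.norm ℝ fun p hp ↦ cross_fderiv_ne_zero (himm p hp)).inv fun p hp ↦
      norm_ne_zero_iff.mpr (cross_fderiv_ne_zero (himm p hp))).smul hc
  inner_fderiv p hp v := by
    rw [eq_combination_single v, map_add, map_smul, map_smul, planeNormal, unitCross,
      real_inner_smul_left, inner_add_right, real_inner_smul_right, real_inner_smul_right,
      inner_cross_left, inner_cross_right]
    simp
  inner_self p hp := by
    have := norm_ne_zero_iff.mpr (cross_fderiv_ne_zero (himm p hp))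
    rw [planeNormal, unitCross, real_inner_smul_left, real_inner_smul_right,
      real_inner_self_eq_norm_sq]
    field_simp

theorem planeNormal_congr {p : Plane} (hfh : f =ᶠ[𝓝 p] h) :
    planeNormal f =ᶠ[𝓝 p] planeNormal h := by
  filter_upwards [eventually_eventually_nhds.mpr hfh] with q hq
  have : fderiv ℝ f q = fderiv ℝ h q := Filter.EventuallyEq.fderiv_eq hq
  rw [planeNormal, planeNormal, this]

/-- A change of basis multiplies the cross product by its determinant, and normalisation removes a
positive factor: the unit normal does not depend on the choice of positive basis. -/
theorem unitCross_comp_of_det_pos (A : Plane →L[ℝ] Space) (L : Plane →L[ℝ] Plane)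
    (hL : 0 < L.det) : unitCross (A (L (EuclideanSpace.single 0 1)))
      (A (L (EuclideanSpace.single 1 1))) =
      unitCross (A (EuclideanSpace.single 0 1)) (A (EuclideanSpace.single 1 1)) := by
  set e₀ : Plane := EuclideanSpace.single 0 1 with he₀
  set e₁ : Plane := EuclideanSpace.single 1 1 with he₁
  have hdet : L.det = L e₀ 0 * L e₁ 1 - L e₁ 0 * L e₀ 1 := by
    rw [ContinuousLinearMap.det,
      ← LinearMap.det_toMatrix (EuclideanSpace.basisFun (Fin 2) ℝ).toBasis, Matrix.det_fin_two]
    simp [LinearMap.toMatrix_apply, he₀, he₁]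
  have h : cross (A (L e₀)) (A (L e₁)) = L.det • cross (A e₀) (A e₁) := by
    rw [eq_combination_single (L e₀), eq_combination_single (L e₁), hdet]
    simp only [map_add, map_smul]
    exact cross_combination _ _ _ _ _ _
  rw [unitCross, unitCross, h, norm_smul, Real.norm_eq_abs, abs_of_pos hL, smul_smul]
  congr 1
  field_simp

theorem hasFDerivAt_affineIsometry (A : Space ≃ᵃⁱ[ℝ] Space) (x : Space) :
    HasFDerivAt A (A.linearIsometryEquiv.toContinuousLinearEquiv : Space →L[ℝ] Space) x := by
  have h : (A : Space → Space) = fun y ↦ A.linearIsometryEquiv y + A 0 := by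
    funext y
    have := A.map_vadd 0 y
    simpa using this
  rw [h]
  exact (A.linearIsometryEquiv.toContinuousLinearEquiv.hasFDerivAt (x := x)).add_const _

end

theorem contDiff_affineIsometry (A : Space ≃ᵃⁱ[ℝ] Space) : ContDiff ℝ ∞ A := by
  have h : (A : Space → Space) = fun y ↦ A.linearIsometryEquiv y + A 0 := by
    funext y
    simpa using A.map_vadd 0 y
  rw [h]
  exact A.linearIsometryEquiv.contDiff.add contDiff_const

/-! ### Transfer between the surface and its charts -/

section

variable {M : Type*} [TopologicalSpace M] [ChartedSpace Plane M]

/-- The derivative at `y` of a chart `e`, in terms of the preferred chart at `y`. -/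
def chartDeriv (e : OpenPartialHomeomorph M Plane) (y : M) :
    TangentSpace (𝓡 2) y →L[ℝ] Plane :=
  mfderiv (𝓡 2) (𝓡 2) e y

variable {e : OpenPartialHomeomorph M Plane} {y : M}

theorem differential_affineIsometry_comp {F : M → Space}
    (hF : ContMDiff (𝓡 2) 𝓘(ℝ, Space) ∞ F) (A : Space ≃ᵃⁱ[ℝ] Space) (v : TangentSpace (𝓡 2) y) :
    differential (fun x ↦ A (F x)) y v = A.linearIsometryEquiv (differential F y v) := by
  have h := mfderiv_comp y (hasFDerivAt_affineIsometry A (F y)).differentiableAt.mdifferentiableAt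
    ((hF.mdifferentiable (by simp)) y)
  rw [mfderiv_eq_fderiv, (hasFDerivAt_affineIsometry A (F y)).fderiv] at h
  change mfderiv (𝓡 2) 𝓘(ℝ, Space) (A ∘ F) y v = _
  rw [h]
  rfl

variable [IsManifold (𝓡 2) ∞ M]

theorem isManifold_one (M : Type*) [TopologicalSpace M] [ChartedSpace Plane M]
    [IsManifold (𝓡 2) ∞ M] : IsManifold (𝓡 2) 1 M :=
  IsManifold.of_le (n := ∞) (by exact_mod_cast le_top)

theorem mdifferentiable_of_mem_atlas' (he : e ∈ atlas Plane M) :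
    e.MDifferentiable (𝓡 2) (𝓡 2) :=
  haveI := isManifold_one M
  mdifferentiable_of_mem_atlas he

theorem chartDeriv_bijective (he : e ∈ atlas Plane M) (hy : y ∈ e.source) :
    Function.Bijective (chartDeriv e y) :=
  (mdifferentiable_of_mem_atlas' he).mfderiv_bijective hy

/-- `TangentSpace (𝓡 2) y` is identified with the plane through the preferred chart at `y`, so
`chartDeriv e y` is the derivative of a transition map of the oriented atlas. -/
theorem chartDeriv_det_pos [OrientedAtlas M] (he : e ∈ atlas Plane M) (hy : y ∈ e.source) :
    0 < ContinuousLinearMap.det (M := Plane) (chartDeriv e y) := by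
  have h := OrientedAtlas.det_pos (chartAt Plane y) (chart_mem_atlas Plane y) e he
    (chartAt Plane y y) (by simp [hy])
  have h2 : chartDeriv e y = fderiv ℝ ((chartAt Plane y).symm ≫ₕ e) (chartAt Plane y y) := by
    have hd := (mdifferentiable_of_mem_atlas' he).mdifferentiableAt hy
    rw [chartDeriv, hd.mfderiv]
    simp [writtenInExtChartAt, Function.comp_def]
    rfl
  rwa [h2]

theorem differential_eq (he : e ∈ atlas Plane M) (hy : y ∈ e.source) {G : M → Space}
    {g : Plane → Space} (hG : G =ᶠ[𝓝 y] g ∘ e) (hg : DifferentiableAt ℝ g (e y))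
    (v : TangentSpace (𝓡 2) y) :
    differential G y v = fderiv ℝ g (e y) (chartDeriv e y v) := by
  have hd := (mdifferentiable_of_mem_atlas' he).mdifferentiableAt hy
  rw [differential, hG.mfderiv_eq, mfderiv_comp y hg.mdifferentiableAt hd, mfderiv_eq_fderiv]
  rfl

theorem contDiffOn_comp_symm (he : e ∈ atlas Plane M) {F : M → Space}
    (hF : ContMDiff (𝓡 2) 𝓘(ℝ, Space) ∞ F) : ContDiffOn ℝ ∞ (F ∘ e.symm) e.target := by
  rw [← contMDiffOn_iff_contDiffOn]
  exact hF.comp_contMDiffOn (contMDiffOn_symm_of_mem_maximalAtlas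
    (IsManifold.subset_maximalAtlas he))

theorem differential_eq_fderiv (he : e ∈ atlas Plane M) (hy : y ∈ e.source) {F : M → Space}
    (hF : ContMDiff (𝓡 2) 𝓘(ℝ, Space) ∞ F) (v : TangentSpace (𝓡 2) y) :
    differential F y v = fderiv ℝ (F ∘ e.symm) (e y) (chartDeriv e y v) :=
  differential_eq he hy (by filter_upwards [e.open_source.mem_nhds hy] with z hz; simp [hz])
    ((contDiffOn_comp_symm he hF).differentiableAt_of_isOpen e.open_target (e.map_source hy)) v

/-- The definition of `unitNormal` uses a chart that varies with the point. Independence of the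
positive basis replaces it by one fixed chart, which makes the normal field smooth and
differentiable in coordinates. -/
theorem unitNormal_eq [OrientedAtlas M] (he : e ∈ atlas Plane M) (hy : y ∈ e.source)
    {F : M → Space} (hF : ContMDiff (𝓡 2) 𝓘(ℝ, Space) ∞ F) :
    unitNormal F y = planeNormal (F ∘ e.symm) (e y) := by
  refine Eq.trans ?_ (unitCross_comp_of_det_pos _ _ (chartDeriv_det_pos he hy))
  change unitCross (differential F y (coordVector y 0)) (differential F y (coordVector y 1)) = _
  rw [differential_eq_fderiv he hy hF, differential_eq_fderiv he hy hF]
  rfl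

variable {g : SurfaceMetric M} {F : M → Space}

/-- An isometric map is an immersion because the metric is positive definite. -/
theorem fderiv_comp_symm_ne_zero (he : e ∈ atlas Plane M) (hF : IsIsometricEmbedding g F)
    {p : Plane} (hp : p ∈ e.target) {v : Plane} (hv : v ≠ 0) :
    fderiv ℝ (F ∘ e.symm) p v ≠ 0 := by
  have hy := e.map_target hp
  obtain ⟨w, rfl⟩ := (chartDeriv_bijective he hy).2 v
  have hw : w ≠ 0 := by
    rintro rfl
    exact hv (map_zero _)
  have h1 := differential_eq_fderiv he hy hF.contMDiff w
  rw [e.right_inv hp] at h1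
  rw [← h1]
  intro h0
  have h2 := g.pos (e.symm p) w hw
  rw [← hF.isometric, h0, inner_zero_left] at h2
  exact lt_irrefl _ h2

theorem inner_fderiv_comp_symm (he : e ∈ atlas Plane M) (hF : IsIsometricEmbedding g F)
    (hy : y ∈ e.source) (v w : TangentSpace (𝓡 2) y) :
    ⟪fderiv ℝ (F ∘ e.symm) (e y) (chartDeriv e y v),
      fderiv ℝ (F ∘ e.symm) (e y) (chartDeriv e y w)⟫ = g.inner y v w := by
  rw [← hF.isometric, differential_eq_fderiv he hy hF.contMDiff,
    differential_eq_fderiv he hy hF.contMDiff]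

theorem isNormalField_comp_symm (he : e ∈ atlas Plane M) (hF : IsIsometricEmbedding g F) :
    IsNormalField e.target (F ∘ e.symm) (planeNormal (F ∘ e.symm)) :=
  isNormalField_planeNormal e.open_target (contDiffOn_comp_symm he hF.contMDiff)
    fun _ hp _ hv ↦ fderiv_comp_symm_ne_zero he hF hp hv

theorem secondFundamentalForm_eq [OrientedAtlas M] (he : e ∈ atlas Plane M)
    (hF : IsIsometricEmbedding g F) (hy : y ∈ e.source) (v w : TangentSpace (𝓡 2) y) :
    secondFundamentalForm F y v w = secondForm (F ∘ e.symm) (planeNormal (F ∘ e.symm)) (e y)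
      (chartDeriv e y v) (chartDeriv e y w) := by
  have hN : unitNormal F =ᶠ[𝓝 y] planeNormal (F ∘ e.symm) ∘ e := by
    filter_upwards [e.open_source.mem_nhds hy] with z hz using unitNormal_eq he hz hF.contMDiff
  rw [secondFundamentalForm, secondForm, differential_eq_fderiv he hy hF.contMDiff,
    differential_eq he hy hN ((isNormalField_comp_symm he hF).smooth_normal.differentiableAt_of_isOpen
      e.open_target (e.map_source hy))]

theorem principalCurvatures_eq [OrientedAtlas M] (he : e ∈ atlas Plane M)
    (hF : IsIsometricEmbedding g F) (hy : y ∈ e.source) :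
    principalCurvatures g F y =
      planePrincipalCurvatures (F ∘ e.symm) (planeNormal (F ∘ e.symm)) (e y) := by
  have hb := chartDeriv_bijective he hy
  ext k
  constructor
  · rintro ⟨v, hv, h⟩
    refine ⟨chartDeriv e y v, fun h0 ↦ hv (hb.1 (h0.trans (map_zero _).symm)), fun w ↦ ?_⟩
    obtain ⟨w, rfl⟩ := hb.2 w
    rw [← secondFundamentalForm_eq he hF hy, inner_fderiv_comp_symm he hF hy]
    exact h w
  · rintro ⟨v, hv, h⟩
    obtain ⟨v, rfl⟩ := hb.2 v
    refine ⟨v, fun h0 ↦ hv (by rw [h0]; exact map_zero _), fun w ↦ ?_⟩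
    rw [secondFundamentalForm_eq he hF hy, ← inner_fderiv_comp_symm he hF hy]
    exact h _

theorem IsIsometricEmbedding.affineIsometry_comp (hF : IsIsometricEmbedding g F)
    (A : Space ≃ᵃⁱ[ℝ] Space) : IsIsometricEmbedding g fun x ↦ A (F x) where
  contMDiff := (contDiff_affineIsometry A).contMDiff.comp hF.contMDiff
  isEmbedding := A.toHomeomorph.isEmbedding.comp hF.isEmbedding
  isometric x v w := by
    rw [differential_affineIsometry_comp hF.contMDiff, differential_affineIsometry_comp hF.contMDiff,
      LinearIsometryEquiv.inner_map_map, hF.isometric]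

/-- The principal curvatures are invariant under proper rigid motions. -/
theorem principalCurvatures_affineIsometry_comp [OrientedAtlas M] (hF : IsIsometricEmbedding g F)
    (A : Space ≃ᵃⁱ[ℝ] Space)
    (hA : LinearMap.det (A.linearIsometryEquiv.toLinearEquiv : Space →ₗ[ℝ] Space) = 1) (x : M) :
    principalCurvatures g (fun x ↦ A (F x)) x = principalCurvatures g F x := by
  -- Determinant one is essential: an improper motion would reverse the normal and change the signs
  -- of the principal curvatures.
  have hN : unitNormal (fun x ↦ A (F x)) = fun x ↦ A.linearIsometryEquiv (unitNormal F x) := by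
    funext y
    change unitCross (differential _ y (coordVector y 0)) (differential _ y (coordVector y 1)) =
      A.linearIsometryEquiv
        (unitCross (differential F y (coordVector y 0)) (differential F y (coordVector y 1)))
    rw [differential_affineIsometry_comp hF.contMDiff, differential_affineIsometry_comp hF.contMDiff,
      unitCross, unitCross, cross_map_of_det_eq_one _ hA, LinearIsometryEquiv.norm_map, map_smul]
  have hII : secondFundamentalForm (fun x ↦ A (F x)) x = secondFundamentalForm F x := by
    funext v w
    have he := chart_mem_atlas Plane x
    have hx := mem_chart_source Plane x
    have hn : DifferentiableAt ℝ (planeNormal (F ∘ (chartAt Plane x).symm)) (chartAt Plane x x) :=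
      (isNormalField_comp_symm he hF).smooth_normal.differentiableAt_of_isOpen
        (chartAt Plane x).open_target (mem_chart_target Plane x)
    have h1 : unitNormal F =ᶠ[𝓝 x] planeNormal (F ∘ (chartAt Plane x).symm) ∘ chartAt Plane x := by
      filter_upwards [(chartAt Plane x).open_source.mem_nhds hx] with z hz
        using unitNormal_eq he hz hF.contMDiff
    have h2 : unitNormal (fun x ↦ A (F x)) =ᶠ[𝓝 x]
        (fun p ↦ A.linearIsometryEquiv (planeNormal (F ∘ (chartAt Plane x).symm) p)) ∘
          chartAt Plane x := by
      filter_upwards [h1] with z hz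
      rw [hN]
      simp [hz]
    have hd := (A.linearIsometryEquiv.toContinuousLinearEquiv.hasFDerivAt.comp _ hn.hasFDerivAt)
    rw [secondFundamentalForm, secondFundamentalForm, differential_affineIsometry_comp hF.contMDiff,
      differential_eq he hx h1 hn, differential_eq he hx h2 hd.differentiableAt,
      show fderiv ℝ (fun p ↦ A.linearIsometryEquiv
        (planeNormal (F ∘ (chartAt Plane x).symm) p)) (chartAt Plane x x) = _ from hd.fderiv]
    exact congrArg Neg.neg (A.linearIsometryEquiv.inner_map_map _ _)
  simp only [principalCurvatures, hII]

/-! ### From local to global -/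

/-- Isometric embeddings with the same principal curvatures that agree on a nonempty open set
agree. -/
theorem eq_of_eqOn_isOpen [OrientedAtlas M] [ConnectedSpace M] {F₁ F₂ : M → Space}
    (hF₁ : IsIsometricEmbedding g F₁) (hF₂ : IsIsometricEmbedding g F₂)
    (hk : ∀ x : M, principalCurvatures g F₁ x = principalCurvatures g F₂ x) {U : Set M}
    (hU : IsOpen U) (hne : U.Nonempty) (hUF : EqOn F₁ F₂ U) : F₁ = F₂ := by
  -- The interior is used because the local theorem starts from agreement in a neighbourhood, not at
  -- a single point.
  set V := interior {x | F₁ x = F₂ x} with hV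
  have hsub : V ⊆ {x | F₁ x = F₂ x} := interior_subset
  have hVne : V.Nonempty := hne.mono (interior_maximal hUF hU)
  have hVc : IsClosed V := by
    refine isClosed_of_closure_subset fun x hx ↦ ?_
    set e := chartAt Plane x with heq
    have he : e ∈ atlas Plane M := chart_mem_atlas Plane x
    have hxs : x ∈ e.source := mem_chart_source Plane x
    obtain ⟨r, hr, hball⟩ := Metric.isOpen_iff.mp e.open_target _ (e.map_source hxs)
    set D := Metric.ball (e x) r
    have hW : IsOpen (e.source ∩ e ⁻¹' D) := e.isOpen_inter_preimage Metric.isOpen_ball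
    have hxW : x ∈ e.source ∩ e ⁻¹' D := ⟨hxs, Metric.mem_ball_self hr⟩
    -- A chart ball around the limit point `x` contains a point `y` of `V`; the ball is convex, so
    -- agreement spreads from `y` to the whole ball and in particular to a neighbourhood of `x`.
    obtain ⟨y, ⟨hys, hyD⟩, hyV⟩ := mem_closure_iff.mp hx _ hW hxW
    have n₁ := isNormalField_comp_symm he hF₁
    have n₂ := isNormalField_comp_symm he hF₂
    have mono : ∀ {f n : Plane → Space}, IsNormalField e.target f n → IsNormalField D f n :=
      fun h ↦ ⟨h.smooth.mono hball, h.smooth_normal.mono hball,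
        fun p hp ↦ h.inner_fderiv p (hball hp), fun p hp ↦ h.inner_self p (hball hp)⟩
    have hev : F₁ ∘ e.symm =ᶠ[𝓝 (e y)] F₂ ∘ e.symm := by
      have hc : Filter.Tendsto e.symm (𝓝 (e y)) (𝓝 y) := e.tendsto_symm hys
      filter_upwards [hc (isOpen_interior.mem_nhds hyV)] with p hp
      exact hsub hp
    have key := eqOn_of_planePrincipalCurvatures_eq Metric.isOpen_ball (convex_ball (e x) r)
      (mono n₁) (mono n₂) (fun p hp v hv ↦ fderiv_comp_symm_ne_zero he hF₁ (hball hp) hv) ?_ ?_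
      hyD hev (planeNormal_congr hev)
    · refine interior_maximal (fun z hz ↦ ?_) hW hxW
      have := key hz.2
      simpa [hz.1] using this
    · intro p hp v w
      have hs := e.map_target (hball hp)
      obtain ⟨v, rfl⟩ := (chartDeriv_bijective he hs).2 v
      obtain ⟨w, rfl⟩ := (chartDeriv_bijective he hs).2 w
      have h1 := inner_fderiv_comp_symm he hF₁ hs v w
      have h2 := inner_fderiv_comp_symm he hF₂ hs v w
      rw [e.right_inv (hball hp)] at h1 h2
      exact h1.trans h2.symm
    · intro p hp
      have hs := e.map_target (hball hp)
      have h1 := principalCurvatures_eq he hF₁ hs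
      have h2 := principalCurvatures_eq he hF₂ hs
      rw [e.right_inv (hball hp)] at h1 h2
      rw [← h1, ← h2, hk]
  have huniv : V = univ := (isClopen_iff.mp ⟨hVc, isOpen_interior⟩).resolve_left hVne.ne_empty
  funext x
  have hx : x ∈ V := huniv ▸ mem_univ x
  exact hsub hx

end

end SurfaceCongruence

end

open SurfaceCongruence in
theorem corollary1p1 {M : Type*} [TopologicalSpace M] [ChartedSpace Plane M]
    [IsManifold (𝓡 2) ∞ M] [OrientedAtlas M] [ConnectedSpace M]
    (g : SurfaceMetric M) (F₁ F₂ : M → Space)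
    (hF₁ : IsIsometricEmbedding g F₁) (hF₂ : IsIsometricEmbedding g F₂)
    (hk : ∀ x : M, principalCurvatures g F₁ x = principalCurvatures g F₂ x)
    (hU : ∃ U : Set M, IsOpen U ∧ U.Nonempty ∧ CongruentOn F₁ F₂ U) :
    AreCongruent F₁ F₂ := by
  obtain ⟨U, hUo, hne, A, hA, hAU⟩ := hU
  -- After the motion `A` the two embeddings coincide on `U`, and `A` changes neither the induced
  -- metric nor the principal curvatures.
  have h := eq_of_eqOn_isOpen (hF₁.affineIsometry_comp A) hF₂
    (fun x ↦ (principalCurvatures_affineIsometry_comp hF₁ A hA x).trans (hk x)) hUo hne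
    (fun x hx ↦ (hAU x hx).symm)
  exact ⟨A, hA, fun x _ ↦ (congrFun h x).symm⟩
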